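/- All graphs are finite, simple and undirected. An orientation $\sigma$ of a graph $G$ maps each edge $\{u,v\}\in E(G)$ to one of its endpoints (its head), giving a directed graph $G_\sigma$. A directed path has pairwise distinct vertices, and a single vertex counts as a path. The orientation $\sigma$ is an sc-orientation if for every ordered pair $(s,t)$ of vertices there is at most one directed path from $s$ to $t$ in $G_\sigma$; $G$ is sc-orientable if it has an sc-orientation. Let $\mathcal{G}_{g,c}$ be the class of graphs whose shortest cycle has length exactly $g$ and whose chromatic number is exactly $c$. An sc-orientable graph $H$ with edges $\{a_1,b_1\},\{a_2,b_2\}\in E(H)$ is a coupling gadget on $(a_1,b_1),(a_2,b_2)$ if 1. for every sc-orientation $\sigma$ of $H$, either $\sigma(\{a_x,b_x\})=b_x$ for both $x\in\{1,2\}$, or $\sigma(\{a_x,b_x\})=a_x$ for both $x\in\{1,2\}$; 2. there is an sc-orientation $\sigma$ of $H$ such that $H_\sigma$ contains no directed path from a vertex of $\{a_1,b_1\}$ to a vertex of $\{a_2,b_2\}$; and 3. there are two proper $\chi(H)$-colorings $f,f'$ of $H$ such that $f(a_1)=f(a_2)$, $f(b_1)=f(b_2)$ and $f'(a_1)=f'(b_2)$,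 $f'(b_1)=f'(a_2)$. Lemma. Let $g\ge 3$ and $c\ge 4$ be integers. There is a graph $G\in\mathcal{G}_{g,c}$ that is not sc-orientable if and only if there is a graph $H\in\mathcal{G}_{g,c}$ that is a coupling gadget on some $(a_1,b_1),(a_2,b_2)$. -/

import Mathlib

namespace Digraph

variable {V : Type*}

/-- `p` is the vertex sequence of a directed path from `s` to `t`: consecutive vertices are
joined by arcs and no vertex is repeated. The one-vertex sequence `[s]` is a path from `s` to `s`. -/
def IsPath (D : Digraph V) (s t : V) (p : List V) : Prop :=
  p.IsChain D.Adj ∧ p.Nodup ∧ p.head? = some s ∧ p.getLast? = some t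

/-- For every ordered pair `(s, t)` there is at most one directed path from `s` to `t`. -/
def SinglyConnected (D : Digraph V) : Prop :=
  ∀ s t : V, ∀ p q : List V, D.IsPath s t p → D.IsPath s t q → p = q

end Digraph

namespace SimpleGraph

variable {V : Type*}

/-- An orientation of the edges of `G`: each edge is mapped to one of its endpoints, its head. -/
structure EdgeOrientation (G : SimpleGraph V) where
  head : G.edgeSet → V
  head_mem : ∀ e : G.edgeSet, head e ∈ (e : Sym2 V)

/-- The directed graph resulting from an orientation: `u → v` if `{u, v}` is an edge with
head `v`. -/
def EdgeOrientation.toDigraph {G : SimpleGraph V} (σ : G.EdgeOrientation) : Digraph V where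
  Adj u v := ∃ h : G.Adj u v, σ.head ⟨s(u, v), h⟩ = v

/-- An orientation is an sc-orientation if the resulting directed graph is singly connected. -/
def EdgeOrientation.IsSC {G : SimpleGraph V} (σ : G.EdgeOrientation) : Prop :=
  σ.toDigraph.SinglyConnected

/-- A graph is sc-orientable if it has an sc-orientation. -/
def SCOrientable (G : SimpleGraph V) : Prop :=
  ∃ σ : G.EdgeOrientation, σ.IsSC

/-- Membership in the class of graphs of girth `g` and chromatic number `c`. -/
def HasGirthAndChromaticNumber (G : SimpleGraph V) (g c : ℕ) : Prop :=
  G.egirth = g ∧ G.chromaticNumber = c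

/-- The edges `(a₁, b₁)` and `(a₂, b₂)`, regarded as ordered pairs, are coupled: every
sc-orientation of `H` has heads `b₁` and `b₂`, or heads `a₁` and `a₂`, on them. -/
def Coupled (H : SimpleGraph V) {a₁ b₁ a₂ b₂ : V} (h₁ : H.Adj a₁ b₁) (h₂ : H.Adj a₂ b₂) : Prop :=
  ∀ σ : H.EdgeOrientation, σ.IsSC →
    (σ.head ⟨s(a₁, b₁), h₁⟩ = b₁ ∧ σ.head ⟨s(a₂, b₂), h₂⟩ = b₂) ∨
    (σ.head ⟨s(a₁, b₁), h₁⟩ = a₁ ∧ σ.head ⟨s(a₂, b₂), h₂⟩ = a₂)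

/-- `H` is a coupling gadget on `(a₁, b₁)`, `(a₂, b₂)`. -/
structure IsCouplingGadget (H : SimpleGraph V) (a₁ b₁ a₂ b₂ : V) : Prop where
  scOrientable : H.SCOrientable
  adj₁ : H.Adj a₁ b₁
  adj₂ : H.Adj a₂ b₂
  coupled : H.Coupled adj₁ adj₂
  no_path : ∃ σ : H.EdgeOrientation, σ.IsSC ∧
    ∀ x ∈ ({a₁, b₁} : Set V), ∀ y ∈ ({a₂, b₂} : Set V),
      ¬ ∃ p : List V, σ.toDigraph.IsPath x y p
  colorings : ∃ k : ℕ, H.chromaticNumber = k ∧ ∃ f f' : H.Coloring (Fin k),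
    (f a₁ = f a₂ ∧ f b₁ = f b₂) ∧ (f' a₁ = f' b₂ ∧ f' b₁ = f' a₂)

end SimpleGraph

/-! From a gadget to a graph: arrange `g + 5` copies of `H` in a ring, identifying the edge `(a₂,
b₂)` of each copy with `(a₁, b₁)` of the next, reversed at exactly one place. In an sc-orientation,
coupling carries the direction of the edge around the ring and the twist reverses it, a
contradiction (`not_scOrientable_twistedRing`). The coloring `f` fits the untwisted copies and `f'`,
with colors permuted, the twisted one. The ring is too long to create short cycles.

From a graph to a gadget: subdivide the edges of a non-sc-orientable `G` one at a time. The full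
subdivision is sc-orientable, so some single subdivision makes the difference (`exists_isSeed`).
This gives a graph `R` such that `R` plus the edge `uv` is not sc-orientable while `R` plus the path
`u w v` is. In every sc-orientation of the latter, `w` is a source or a sink, since a directed path
`u w v` could be contracted to an arc (`IsSeed.not_adj_through`). So `R` forces the two edges of any
two-edge path between its terminals to point both towards or both away from the middle. Glue two
copies of `R` in a row, with terminals 0, 1, 2, take this twice (left and right), and add the path
L0 R0 L1 R1 L2 R2. Consecutive edges of it are two-edge paths between terminals of a copy of `R`, so
all of its edges point left to right or all right to left, which couples L0R0 with L2R2. Reversing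
the right side yields an sc-orientation without paths from the first edge to the second. Four colors
suffice for both colorings of the terminals.

Exact girth and chromatic number come from a disjoint union with an sc-orientable graph having these
values: a cycle of length `g` together with a `c`-chromatic graph of large girth, oriented by
increasing color. The latter exists by Erdős's probabilistic argument, here a counting argument.

Girth bounds all use one certificate: an edge `xy` lies on no cycle shorter than `g` iff some
integer function changes by at most 1 along every other edge and by at least `g - 1` between `x` and
`y` (`le_egirth_of_potential`, `exists_potential`). Such functions can be pasted along gluings, so
cycles in composite graphs need not be analysed. -/

namespace Digraph

/-! ### Directed paths, reachability and a local criterion for single connectedness -/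

variable {V W : Type*}

/-- The digraph `D` arises from the graph `G` by orienting every edge. -/
structure Orients (D : Digraph V) (G : SimpleGraph V) : Prop where
  adj : ∀ {x y}, D.Adj x y → G.Adj x y
  total : ∀ {x y}, G.Adj x y → D.Adj x y ∨ D.Adj y x
  asymm : ∀ {x y}, D.Adj x y → ¬ D.Adj y x

theorem Orients.irrefl {D : Digraph V} {G : SimpleGraph V} (h : D.Orients G) (x : V) :
    ¬ D.Adj x x := fun hx => G.irrefl (h.adj hx)

theorem Orients.not_adj_iff {D : Digraph V} {G : SimpleGraph V} (h : D.Orients G) {x y : V}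
    (hxy : G.Adj x y) : ¬ D.Adj x y ↔ D.Adj y x :=
  ⟨fun hn => (h.total hxy).resolve_left hn, fun hn => h.asymm hn⟩

/-- The digraph with all arcs reversed. -/
def rev (D : Digraph V) : Digraph V where
  Adj x y := D.Adj y x

theorem Orients.rev {D : Digraph V} {G : SimpleGraph V} (h : D.Orients G) : D.rev.Orients G :=
  ⟨fun h' => (h.adj h').symm, fun h' => h.total h'.symm, fun h' => h.asymm h'⟩

theorem IsPath.rev {D : Digraph V} {s t : V} {p : List V} (h : D.IsPath s t p) :
    D.rev.IsPath t s p.reverse := by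
  obtain ⟨h1, h2, h3, h4⟩ := h
  exact ⟨List.isChain_reverse.2 h1, List.nodup_reverse.2 h2, by simpa using h4, by simpa using h3⟩

theorem SinglyConnected.rev {D : Digraph V} (h : D.SinglyConnected) : D.rev.SinglyConnected := by
  intro s t p q hp hq
  exact List.reverse_injective (h t s _ _ hp.rev hq.rev)

/-- The digraph induced along a map. -/
def pull (D : Digraph W) (G : SimpleGraph V) (f : V → W) : Digraph V where
  Adj x y := G.Adj x y ∧ D.Adj (f x) (f y)

theorem IsPath.map {D : Digraph W} {D' : Digraph V} {f : V → W} (hf : Function.Injective f)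
    (hD : ∀ x y, D'.Adj x y → D.Adj (f x) (f y)) {s t : V} {p : List V} (h : D'.IsPath s t p) :
    D.IsPath (f s) (f t) (p.map f) := by
  obtain ⟨h1, h2, h3, h4⟩ := h
  refine ⟨?_, h2.map hf, by simp [h3], by simp [h4]⟩
  rw [List.isChain_map]
  exact h1.imp hD

theorem SinglyConnected.of_injective {D : Digraph W} {D' : Digraph V} (h : D.SinglyConnected)
    {f : V → W} (hf : Function.Injective f) (hD : ∀ x y, D'.Adj x y → D.Adj (f x) (f y)) :
    D'.SinglyConnected := by
  intro s t p q hp hq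
  exact List.map_injective_iff.2 hf (h _ _ _ _ (hp.map hf hD) (hq.map hf hD))

theorem Orients.pull {D : Digraph W} {G : SimpleGraph V} {H : SimpleGraph W} (h : D.Orients H)
    {f : V → W} (hf : ∀ x y, G.Adj x y → H.Adj (f x) (f y)) : (D.pull G f).Orients G :=
  ⟨fun h' => h'.1, fun h' => (h.total (hf _ _ h')).imp (fun a => ⟨h', a⟩) fun a => ⟨h'.symm, a⟩,
    fun h' h'' => h.asymm h'.2 h''.2⟩

theorem exists_nodup_chain {r : V → V → Prop} {x t : V} (h : Relation.ReflTransGen r x t) :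
    ∃ p : List V, p.IsChain r ∧ p.Nodup ∧ p.head? = some x ∧ p.getLast? = some t := by
  classical
  induction h using Relation.ReflTransGen.head_induction_on with
  | refl => exact ⟨[t], by simp⟩
  | @head a c hac _ ih =>
    obtain ⟨p, h1, h2, h3, h4⟩ := ih
    -- If the new head already lies on the path, the suffix starting there replaces the path.
    by_cases ha : a ∈ p
    · obtain ⟨l₁, l₂, rfl⟩ := List.append_of_mem ha
      refine ⟨a :: l₂, h1.right_of_append, (List.nodup_append.1 h2).2.1, rfl, ?_⟩
      rwa [List.getLast?_append_of_ne_nil _ (by simp)] at h4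
    · refine ⟨a :: p, ?_, List.nodup_cons.2 ⟨ha, h2⟩, rfl, ?_⟩
      · cases p with
        | nil => simp
        | cons b l =>
          simp only [List.head?_cons, Option.some.injEq] at h3
          subst h3
          exact List.isChain_cons_cons.2 ⟨hac, h1⟩
      · cases p with
        | nil => simp at h3
        | cons b l => rw [List.getLast?_cons_cons]; exact h4

theorem reflTransGen_of_chain {r : V → V → Prop} {p : List V} {x t : V} (h : p.IsChain r)
    (h3 : p.head? = some x) (h4 : p.getLast? = some t) : Relation.ReflTransGen r x t := by
  induction p generalizing x with
  | nil => simp at h3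
  | cons a l ih =>
    simp only [List.head?_cons, Option.some.injEq] at h3
    subst h3
    cases l with
    | nil => simp at h4; subst h4; exact .refl
    | cons b l =>
      rw [List.getLast?_cons_cons] at h4
      rw [List.isChain_cons_cons] at h
      exact .head h.1 (ih h.2 rfl h4)

/-- `t` can be reached from `x` without entering `s`. -/
def ReachAvoiding (D : Digraph V) (s : V) : V → V → Prop :=
  Relation.ReflTransGen fun p q => D.Adj p q ∧ q ≠ s

/-- `t` can be reached from `x`. -/
def Reach (D : Digraph V) : V → V → Prop :=
  Relation.ReflTransGen D.Adj

theorem ReachAvoiding.reach {D : Digraph V} {s x t : V} (h : D.ReachAvoiding s x t) :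
    D.Reach x t := Relation.ReflTransGen.mono (p := D.Adj) (fun _ _ h => h.1) _ _ h

theorem IsPath.reach {D : Digraph V} {s t : V} {p : List V} (h : D.IsPath s t p) : D.Reach s t :=
  reflTransGen_of_chain h.1 h.2.2.1 h.2.2.2

theorem not_mem_of_chain {D : Digraph V} {s x : V} (hx : x ≠ s) {p : List V}
    (h : p.IsChain fun p q => D.Adj p q ∧ q ≠ s) (h3 : p.head? = some x) : s ∉ p := by
  induction p generalizing x with
  | nil => simp
  | cons a l ih =>
    simp only [List.head?_cons, Option.some.injEq] at h3
    subst h3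
    cases l with
    | nil => simpa using hx.symm
    | cons b l =>
      rw [List.isChain_cons_cons] at h
      rw [List.mem_cons, not_or]
      exact ⟨hx.symm, ih h.1.2 h.2 rfl⟩

theorem ReachAvoiding.exists_path {D : Digraph V} {s x t : V} (hs : D.Adj s x) (hx : x ≠ s)
    (h : D.ReachAvoiding s x t) : ∃ p : List V, p.head? = some x ∧ D.IsPath s t (s :: p) := by
  obtain ⟨p, h1, h2, h3, h4⟩ := exists_nodup_chain h
  have hsp := not_mem_of_chain hx h1 h3
  refine ⟨p, h3, ?_, List.nodup_cons.2 ⟨hsp, h2⟩, rfl, ?_⟩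
  · cases p with
    | nil => simp
    | cons b l =>
      simp only [List.head?_cons, Option.some.injEq] at h3
      subst h3
      exact List.isChain_cons_cons.2 ⟨hs, h1.imp fun _ _ h => h.1⟩
  · cases p with
    | nil => simp at h3
    | cons b l => rw [List.getLast?_cons_cons]; exact h4

theorem chain_avoiding {D : Digraph V} {s : V} {p : List V} (h : p.IsChain D.Adj) (hs : s ∉ p) :
    p.IsChain fun p q => D.Adj p q ∧ q ≠ s := by
  induction p with
  | nil => simp
  | cons a l ih =>
    cases l with
    | nil => simp
    | cons b l =>
      rw [List.isChain_cons_cons] at h ⊢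
      simp only [List.mem_cons, not_or] at hs ih
      exact ⟨⟨h.1, fun e => hs.2.1 e.symm⟩, ih h.2 hs.2⟩

/-- A loopless digraph is singly connected iff distinct out-neighbours of a vertex `s` reach
disjoint sets of vertices when `s` is avoided. -/
theorem singlyConnected_iff {D : Digraph V} (hD : ∀ x, ¬ D.Adj x x) :
    D.SinglyConnected ↔ ∀ s x y t, D.Adj s x → D.Adj s y → D.ReachAvoiding s x t →
      D.ReachAvoiding s y t → x = y := by
  constructor
  · intro h s x y t hx hy hxt hyt
    obtain ⟨p, hp, hp'⟩ := hxt.exists_path hx (by rintro rfl; exact hD _ hx)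
    obtain ⟨q, hq, hq'⟩ := hyt.exists_path hy (by rintro rfl; exact hD _ hy)
    have := h s t _ _ hp' hq'
    rw [List.cons.injEq] at this
    rw [this.2, hq] at hp
    exact (Option.some.inj hp).symm
  · intro h s t p
    induction p generalizing s with
    | nil => rintro q ⟨-, -, h3, -⟩; simp at h3
    | cons a p ih =>
      rintro q ⟨h1, h2, h3, h4⟩ ⟨k1, k2, k3, k4⟩
      simp only [List.head?_cons, Option.some.injEq] at h3
      subst h3
      cases q with
      | nil => simp at k3
      | cons a' q =>
        simp only [List.head?_cons, Option.some.injEq] at k3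
        subst k3
        rw [List.nodup_cons] at h2 k2
        cases p with
        | nil =>
          cases q with
          | nil => rfl
          | cons y q =>
            simp only [List.getLast?_singleton, Option.some.injEq] at h4
            rw [List.getLast?_cons_cons] at k4
            exact absurd (h4 ▸ List.mem_of_getLast? k4) k2.1
        | cons x p =>
          cases q with
          | nil =>
            simp only [List.getLast?_singleton, Option.some.injEq] at k4
            rw [List.getLast?_cons_cons] at h4
            exact absurd (k4 ▸ List.mem_of_getLast? h4) h2.1
          | cons y q =>
            rw [List.getLast?_cons_cons] at h4 k4
            rw [List.isChain_cons_cons] at h1 k1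
            -- As no vertex repeats, both tails avoid the starting vertex, so the criterion forces
            -- equal second vertices.
            have hxy : x = y := h a' x y t h1.1 k1.1
              (reflTransGen_of_chain (chain_avoiding h1.2 h2.1) rfl h4)
              (reflTransGen_of_chain (chain_avoiding k1.2 k2.1) rfl k4)
            subst hxy
            rw [ih x (x :: q) ⟨h1.2, h2.2, rfl, h4⟩ ⟨k1.2, k2.2, rfl, k4⟩]

/-- In a singly connected digraph, two vertices with a common out-neighbour `w` which is a sink
are not reachable from the same vertex. -/
theorem SinglyConnected.eq_of_reach_of_sink {D : Digraph V} (h : D.SinglyConnected)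
    {s u v w : V} (hw : ∀ x, ¬ D.Adj w x) (hu : D.Adj u w) (hv : D.Adj v w)
    (hsu : D.Reach s u) (hsv : D.Reach s v) : u = v := by
  have key : ∀ u, D.Adj u w → D.Reach s u →
      ∃ p : List V, p.getLast? = some u ∧ D.IsPath s w (p ++ [w]) := by
    intro u hu hsu
    obtain ⟨p, h1, h2, h3, h4⟩ := exists_nodup_chain hsu
    refine ⟨p, h4, ?_, ?_, ?_, by simp⟩
    · rw [List.isChain_append]
      refine ⟨h1, by simp, ?_⟩
      intro x hx y hy
      rw [h4] at hx
      simp at hx hy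
      subst hx hy
      exact hu
    · rw [List.nodup_append]
      refine ⟨h2, by simp, ?_⟩
      rintro a ha b hb rfl
      simp only [List.mem_singleton] at hb
      subst hb
      -- A sink can only be the last vertex of a path, but the last vertex `u` has the arc to `w`.
      obtain ⟨l₁, l₂, rfl⟩ := List.append_of_mem ha
      have h5 := h1.right_of_append
      rw [List.getLast?_append_of_ne_nil _ (by simp)] at h4
      cases l₂ with
      | nil => simp at h4; subst h4; exact hw _ hu
      | cons b l => exact hw _ (List.isChain_cons_cons.1 h5).1
    · simp [h3]
  obtain ⟨p, hp, hp'⟩ := key u hu hsu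
  obtain ⟨q, hq, hq'⟩ := key v hv hsv
  have := List.append_cancel_right (h s w _ _ hp' hq')
  rw [this, hq] at hp
  exact (Option.some.inj hp).symm

end Digraph

/-! ### Orientations as digraphs, potentials certifying girth, recoloring -/

namespace SimpleGraph

variable {V W : Type*} {G : SimpleGraph V}

theorem EdgeOrientation.head_eq_right_iff (σ : G.EdgeOrientation) {a b : V} (h : G.Adj a b) :
    σ.head ⟨s(a, b), h⟩ = b ↔ σ.toDigraph.Adj a b :=
  ⟨fun h' => ⟨h, h'⟩, fun ⟨_, h'⟩ => h'⟩

theorem EdgeOrientation.head_eq_left_iff (σ : G.EdgeOrientation) {a b : V} (h : G.Adj a b) :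
    σ.head ⟨s(a, b), h⟩ = a ↔ σ.toDigraph.Adj b a := by
  rw [← σ.head_eq_right_iff h.symm]
  have : (⟨s(a, b), h⟩ : G.edgeSet) = ⟨s(b, a), h.symm⟩ := Subtype.ext Sym2.eq_swap
  rw [this]

theorem EdgeOrientation.orients (σ : G.EdgeOrientation) : σ.toDigraph.Orients G where
  adj h := h.1
  total {x y} h := by
    rw [← σ.head_eq_right_iff h, ← σ.head_eq_left_iff h]
    simpa [or_comm] using σ.head_mem ⟨s(x, y), h⟩
  asymm {x y} h h' := by
    have h1 := (σ.head_eq_right_iff h.1).2 h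
    have h2 := (σ.head_eq_left_iff h.1).2 h'
    exact h.1.ne (h2.symm.trans h1)

theorem exists_edgeOrientation {D : Digraph V} (hD : D.Orients G) :
    ∃ σ : G.EdgeOrientation, σ.toDigraph = D := by
  classical
  have : ∀ e : G.edgeSet, ∃ v u, (e : Sym2 V) = s(u, v) ∧ D.Adj u v := by
    rintro ⟨e, he⟩
    induction e with
    | _ x y =>
      rcases hD.total he with h | h
      · exact ⟨y, x, rfl, h⟩
      · exact ⟨x, y, Sym2.eq_swap, h⟩
  choose f k hk hf using this
  refine ⟨⟨f, fun e => by rw [hk]; simp⟩, ?_⟩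
  ext x y
  constructor
  · rintro ⟨h, h'⟩
    have h1 := hk ⟨s(x, y), h⟩
    have h2 := hf ⟨s(x, y), h⟩
    simp only at h' h1
    rw [h'] at h1 h2
    have : k ⟨s(x, y), h⟩ = x := by
      simp only [Sym2.eq_iff] at h1
      rcases h1 with h1 | h1
      · exact h1.1.symm
      · exact absurd h1.1 h.ne
    rwa [this] at h2
  · intro h
    refine ⟨hD.adj h, ?_⟩
    have h1 := hk ⟨s(x, y), hD.adj h⟩
    have h2 := hf ⟨s(x, y), hD.adj h⟩
    simp only [Sym2.eq_iff] at h1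
    rcases h1 with h1 | h1
    · exact h1.2.symm
    · rw [← h1.1, ← h1.2] at h2
      exact absurd h2 (hD.asymm h)

theorem scOrientable_iff : G.SCOrientable ↔ ∃ D : Digraph V, D.Orients G ∧ D.SinglyConnected := by
  constructor
  · rintro ⟨σ, h⟩
    exact ⟨_, σ.orients, h⟩
  · rintro ⟨D, h, h'⟩
    obtain ⟨σ, rfl⟩ := exists_edgeOrientation h
    exact ⟨σ, h'⟩

theorem coupled_iff {a₁ b₁ a₂ b₂ : V} (h₁ : G.Adj a₁ b₁) (h₂ : G.Adj a₂ b₂) :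
    G.Coupled h₁ h₂ ↔ ∀ D : Digraph V, D.Orients G → D.SinglyConnected →
      (D.Adj a₁ b₁ ↔ D.Adj a₂ b₂) := by
  constructor
  · intro h D hD hs
    obtain ⟨σ, rfl⟩ := exists_edgeOrientation hD
    have := h σ hs
    rw [σ.head_eq_right_iff, σ.head_eq_right_iff, σ.head_eq_left_iff, σ.head_eq_left_iff] at this
    have k₁ := hD.not_adj_iff h₁
    have k₂ := hD.not_adj_iff h₂
    tauto
  · intro h σ hs
    rw [σ.head_eq_right_iff, σ.head_eq_right_iff, σ.head_eq_left_iff, σ.head_eq_left_iff]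
    have := h _ σ.orients hs
    have k₁ := σ.orients.not_adj_iff h₁
    have k₂ := σ.orients.not_adj_iff h₂
    tauto

theorem SCOrientable.of_injective {H : SimpleGraph W} (h : H.SCOrientable) {f : V → W}
    (hf : Function.Injective f) (hG : ∀ x y, G.Adj x y → H.Adj (f x) (f y)) :
    G.SCOrientable := by
  rw [scOrientable_iff] at h ⊢
  obtain ⟨D, h1, h2⟩ := h
  exact ⟨D.pull G f, h1.pull hG, h2.of_injective hf fun _ _ h => h.2⟩

/-- `h` is an integer potential that changes by at most one along every edge of `G` except
possibly `e`. -/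
def LipschitzOff (G : SimpleGraph V) (e : Sym2 V) (h : V → ℤ) : Prop :=
  ∀ p q, G.Adj p q → s(p, q) ≠ e → |h p - h q| ≤ 1

theorem LipschitzOff.abs_sub_le {e : Sym2 V} {h : V → ℤ} (hh : G.LipschitzOff e h) {x y : V}
    (p : G.Walk x y) (hp : e ∉ p.edges) : |h x - h y| ≤ p.length := by
  induction p with
  | nil => simp
  | @cons a b c hab p ih =>
    simp only [Walk.edges_cons, List.mem_cons, not_or] at hp
    have h1 := hh _ _ hab (fun e' => hp.1 e'.symm)
    have h2 := ih hp.2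
    have h3 := _root_.abs_sub_le (h a) (h b) (h c)
    simp only [Walk.length_cons, Nat.cast_add, Nat.cast_one]
    linarith

/-- A cycle through `xy` without that edge is a walk from `y` to `x` on which `h` moves by at most 1
per step, so it has at least `g - 1` steps. -/
theorem le_egirth_of_potential {g : ℕ}
    (H : ∀ x y, G.Adj x y → ∃ h, G.LipschitzOff s(x, y) h ∧ (g : ℤ) - 1 ≤ |h x - h y|) :
    (g : ℕ∞) ≤ G.egirth := by
  rw [le_egirth]
  intro a w hw
  cases w with
  | nil => simp at hw
  | @cons _ b _ hab p =>
    rw [Walk.cons_isCycle_iff] at hw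
    obtain ⟨h, h1, h2⟩ := H a b hab
    have := h1.abs_sub_le p hw.2
    rw [abs_sub_comm] at this
    rw [Walk.length_cons]
    have : (g : ℤ) ≤ (p.length + 1 : ℕ) := by push_cast; linarith
    exact_mod_cast this

/-- The potential is the distance from `x` after deleting `xy`, truncated at `g - 1`; truncation
also handles unreachable vertices. At `y` it equals `g - 1`, because a shorter path would close up
with `xy` to a short cycle. -/
theorem exists_potential {g : ℕ} (hg : 1 ≤ g) (hG : (g : ℕ∞) ≤ G.egirth) {x y : V}
    (hxy : G.Adj x y) : ∃ h : V → ℤ, G.LipschitzOff s(x, y) h ∧ h x = 0 ∧ h y = g - 1 ∧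
      ∀ z, 0 ≤ h z ∧ h z ≤ g - 1 := by
  classical
  let G' := G.deleteEdges {s(x, y)}
  let d : V → ℕ∞ := fun z => min (G'.edist x z) ((g - 1 : ℕ) : ℕ∞)
  have hd : ∀ z, d z ≠ ⊤ := fun z => ne_top_of_le_ne_top (ENat.natCast_ne_top _) (min_le_right _ _)
  have hd' : ∀ z, ((d z).toNat : ℕ∞) = d z := fun z => ENat.natCast_toNat (hd z)
  have hle : ∀ z, (d z).toNat ≤ g - 1 := fun z => by
    have : d z ≤ ((g - 1 : ℕ) : ℕ∞) := min_le_right _ _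
    rw [← hd'] at this
    exact_mod_cast this
  have step : ∀ p q, G'.Adj p q → (d q).toNat ≤ (d p).toNat + 1 := by
    intro p q hpq
    have h1 : G'.edist x q ≤ G'.edist x p + 1 := by
      rw [← edist_eq_one_iff_adj.2 hpq]
      exact SimpleGraph.edist_triangle
    have : d q ≤ d p + 1 := by
      simp only [d]
      rcases le_total (G'.edist x p) ((g - 1 : ℕ) : ℕ∞) with h | h
      · rw [min_eq_left h]
        exact (min_le_left _ _).trans h1
      · rw [min_eq_right h]
        exact (min_le_right _ _).trans le_self_add
    rw [← hd' q, ← hd' p] at this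
    exact_mod_cast this
  refine ⟨fun z => (d z).toNat, ?_, ?_, ?_, ?_⟩
  · intro p q hpq hne
    have hpq' : G'.Adj p q := by simpa [G', deleteEdges_adj] using ⟨hpq, by simpa using hne⟩
    have h1 := step p q hpq'
    have h2 := step q p hpq'.symm
    simp only [abs_le]
    omega
  · have : d x = 0 := by simp [d]
    simp [this]
  · suffices h : d y = ((g - 1 : ℕ) : ℕ∞) by
      simp only [h, ENat.toNat_natCast]
      omega
    refine min_eq_right ?_
    by_contra! hlt
    obtain ⟨p, hp⟩ := exists_walk_of_edist_ne_top (ne_top_of_lt hlt)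
    have hp2 : (p.bypass.length : ℕ∞) < ((g - 1 : ℕ) : ℕ∞) := by
      refine lt_of_le_of_lt ?_ (hp ▸ hlt)
      exact_mod_cast p.length_bypass_le_length
    have hle : G' ≤ G := deleteEdges_le _
    have hcyc : (Walk.cons hxy.symm (p.bypass.mapLe hle)).IsCycle := by
      rw [Walk.cons_isCycle_iff]
      refine ⟨(Walk.isPath_mapLe hle).2 p.bypass_isPath, ?_⟩
      rw [Walk.edges_mapLe_eq_edges]
      intro hmem
      have := p.bypass.edges_subset_edgeSet hmem
      simp [G', Sym2.eq_swap] at this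
    have h3 := le_egirth.1 hG _ _ hcyc
    have h4 : (p.bypass.length) < g - 1 := by exact_mod_cast hp2
    simp only [Walk.length_cons, Walk.length_map] at h3
    have h5 : g ≤ p.bypass.length + 1 := by
      exact_mod_cast h3
    omega
  · intro z
    have := hle z
    simp only
    omega

/-- Permuting the colors moves two distinct ones to any two distinct ones and preserves equality of
colors, which is what pasting colorings needs. -/
theorem Coloring.exists_recolor {c : ℕ} (f : G.Coloring (Fin c)) {u v : V} (huv : f u ≠ f v)
    {α β : Fin c} (hαβ : α ≠ β) : ∃ f' : G.Coloring (Fin c), f' u = α ∧ f' v = β ∧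
      ∀ x y, f x = f y → f' x = f' y := by
  have : ∃ π : Equiv.Perm (Fin c), π (f u) = α ∧ π (f v) = β := by
    let π₁ := Equiv.swap (f u) α
    have h1 : π₁ (f u) = α := Equiv.swap_apply_left _ _
    have h2 : π₁ (f v) ≠ α := fun h => huv (π₁.injective (h1.trans h.symm))
    refine ⟨π₁.trans (Equiv.swap (π₁ (f v)) β), ?_, ?_⟩
    · simp only [Equiv.trans_apply, h1]
      exact Equiv.swap_apply_of_ne_of_ne h2.symm hαβ
    · simp
  obtain ⟨π, h1, h2⟩ := this
  refine ⟨Coloring.mk (fun x => π (f x)) fun {x y} hxy h => f.valid hxy (π.injective h),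
    h1, h2, fun x y h => congrArg π h⟩

end SimpleGraph

/-! ### The twisted ring: from a coupling gadget to a non-sc-orientable graph -/

namespace SimpleGraph

section Ring

variable {W : Type*} {k : ℕ} (a₁ b₁ a₂ b₂ : W)

open Classical in
/-- First end of the edge to which `(a₂, b₂)` of the `i`-th copy is glued. -/
noncomputable def ringFst (i : ZMod k) : W := if i = -1 then b₁ else a₁

open Classical in
/-- Second end of the edge to which `(a₂, b₂)` of the `i`-th copy is glued. -/
noncomputable def ringSnd (i : ZMod k) : W := if i = -1 then a₁ else b₁

open Classical in
/-- The `i`-th of `k` copies of `W` arranged in a ring: the pair `(a₂, b₂)` of each copy is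
identified with `(a₁, b₁)` of the next one, with a twist at the last copy. -/
noncomputable def ringMap (i : ZMod k) (z : W) : ZMod k × W :=
  if z = a₂ then (i + 1, ringFst a₁ b₁ i) else if z = b₂ then (i + 1, ringSnd a₁ b₁ i) else (i, z)

/-- A twisted ring of `k` copies of `H`. -/
noncomputable def twistedRing (H : SimpleGraph W) (k : ℕ) : SimpleGraph (ZMod k × W) :=
  ⨆ i, H.map (ringMap a₁ b₁ a₂ b₂ i)

variable {a₁ b₁ a₂ b₂}

theorem ringFst_ne_ringSnd (h : a₁ ≠ b₁) (i : ZMod k) : ringFst a₁ b₁ i ≠ ringSnd a₁ b₁ i := by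
  unfold ringFst ringSnd
  split_ifs
  · exact h.symm
  · exact h

theorem ringMap_injective (hk : 2 ≤ k) (h₁ : a₁ ≠ b₁) (i : ZMod k) :
    Function.Injective (ringMap a₁ b₁ a₂ b₂ i) := by
  have hne : i + 1 ≠ i := by
    have : Fact (1 < k) := ⟨hk⟩
    simp
  have := ringFst_ne_ringSnd h₁ i
  intro x y h
  unfold ringMap at h
  split_ifs at h <;> simp_all

theorem ringMap_of_ne {i : ZMod k} {z : W} (h : z ≠ a₂) (h' : z ≠ b₂) :
    ringMap a₁ b₁ a₂ b₂ i z = (i, z) := by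
  simp [ringMap, h, h']

theorem ringMap_fst (i : ZMod k) : ringMap a₁ b₁ a₂ b₂ i a₂ = (i + 1, ringFst a₁ b₁ i) := by
  simp [ringMap]

theorem ringMap_snd (h : a₂ ≠ b₂) (i : ZMod k) :
    ringMap a₁ b₁ a₂ b₂ i b₂ = (i + 1, ringSnd a₁ b₁ i) := by
  simp [ringMap, h.symm]

theorem twistedRing_adj_iff {H : SimpleGraph W} {p q : ZMod k × W} (hk : 2 ≤ k) (h₁ : a₁ ≠ b₁) :
    (H.twistedRing a₁ b₁ a₂ b₂ k).Adj p q ↔ ∃ i x y, H.Adj x y ∧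
      ringMap a₁ b₁ a₂ b₂ i x = p ∧ ringMap a₁ b₁ a₂ b₂ i y = q := by
  simp only [twistedRing, iSup_adj, map_adj']
  constructor
  · rintro ⟨i, -, x, y, h⟩
    exact ⟨i, x, y, h⟩
  · rintro ⟨i, x, y, h, rfl, rfl⟩
    exact ⟨i, (ringMap_injective hk h₁ i).ne h.ne, x, y, h, rfl, rfl⟩

theorem twistedRing_adj {H : SimpleGraph W} (hk : 2 ≤ k) (h₁ : a₁ ≠ b₁) (i : ZMod k) {x y : W}
    (h : H.Adj x y) : (H.twistedRing a₁ b₁ a₂ b₂ k).Adj (ringMap a₁ b₁ a₂ b₂ i x)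
      (ringMap a₁ b₁ a₂ b₂ i y) :=
  (twistedRing_adj_iff hk h₁).2 ⟨i, x, y, h, rfl, rfl⟩

variable {H : SimpleGraph W}

/-- Each copy inherits an sc-orientation, so the direction of its first edge passes to the next copy
unchanged, except that copy `-1` hands it to copy `0` reversed. -/
theorem not_scOrientable_twistedRing (hk : 2 ≤ k) (h₁ : H.Adj a₁ b₁) (h₂ : H.Adj a₂ b₂)
    (ha₁ : a₁ ≠ a₂) (ha₂ : a₁ ≠ b₂) (hb₁ : b₁ ≠ a₂) (hb₂ : b₁ ≠ b₂) (hc : H.Coupled h₁ h₂) :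
    ¬ (H.twistedRing a₁ b₁ a₂ b₂ k).SCOrientable := by
  rw [scOrientable_iff]
  rintro ⟨D, hD, hs⟩
  rw [coupled_iff] at hc
  have step : ∀ i : ZMod k, D.Adj (i, a₁) (i, b₁) ↔
      D.Adj (i + 1, ringFst a₁ b₁ i) (i + 1, ringSnd a₁ b₁ i) := by
    intro i
    have := hc (D.pull H (ringMap a₁ b₁ a₂ b₂ i))
      (hD.pull fun x y h => twistedRing_adj hk h₁.ne i h)
      (hs.of_injective (ringMap_injective hk h₁.ne i) fun _ _ h => h.2)
    simpa [Digraph.pull, h₁, h₂, ringMap_of_ne ha₁ ha₂, ringMap_of_ne hb₁ hb₂, ringMap_fst,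
      ringMap_snd h₂.ne] using this
  have key : ∀ m : ℕ, m < k → (D.Adj ((0 : ZMod k), a₁) (0, b₁) ↔
      D.Adj ((m : ZMod k), a₁) ((m : ZMod k), b₁)) := by
    intro m
    induction m with
    | zero => simp
    | succ m ih =>
      intro hm
      have hne : (m : ZMod k) ≠ -1 := by
        intro h
        have h0 : ((m + 1 : ℕ) : ZMod k) = 0 := by push_cast; rw [h]; ring
        rw [ZMod.natCast_eq_zero_iff] at h0
        exact absurd (Nat.le_of_dvd (by omega) h0) (by omega)
      rw [ih (by omega), step]
      simp [ringFst, ringSnd, hne]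
  have h1 := key (k - 1) (by omega)
  have hcast : ((k - 1 : ℕ) : ZMod k) = -1 := by
    rw [Nat.cast_sub (by omega)]
    simp
  rw [hcast, step (-1)] at h1
  simp only [ringFst, ringSnd, if_true, neg_add_cancel] at h1
  have hadj := twistedRing_adj (a₂ := a₂) (b₂ := b₂) hk h₁.ne (0 : ZMod k) h₁
  rw [ringMap_of_ne ha₁ ha₂, ringMap_of_ne hb₁ hb₂] at hadj
  have := hD.not_adj_iff hadj
  tauto

theorem colorable_twistedRing {c : ℕ} (hk : 2 ≤ k) (h₁ : H.Adj a₁ b₁) (h₂ : H.Adj a₂ b₂)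
    (f f' : H.Coloring (Fin c)) (hf : f a₁ = f a₂ ∧ f b₁ = f b₂)
    (hf' : f' a₁ = f' b₂ ∧ f' b₁ = f' a₂) : (H.twistedRing a₁ b₁ a₂ b₂ k).Colorable c := by
  classical
  -- `F` colors the twisted copy: it agrees with `f` on the first edge and, like `f'`, swaps the two
  -- colors on the second.
  obtain ⟨F, hF₁, hF₂, hF⟩ := f'.exists_recolor (f'.valid h₁) (f.valid h₁)
  let col : ZMod k × W → Fin c := fun p => if p.1 = -1 then F p.2 else f p.2
  have hcola : ∀ i, col (i, a₁) = f a₁ := fun i => by simp only [col]; split_ifs <;> simp [hF₁]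
  have hcolb : ∀ i, col (i, b₁) = f b₁ := fun i => by simp only [col]; split_ifs <;> simp [hF₂]
  have key : ∀ i z, col (ringMap a₁ b₁ a₂ b₂ i z) = if i = -1 then F z else f z := by
    intro i z
    by_cases hz : z = a₂
    · subst hz
      rw [ringMap_fst]
      unfold ringFst
      split_ifs
      · rw [hcolb, ← hF₂, hF _ _ hf'.2]
      · rw [hcola, hf.1]
    by_cases hz' : z = b₂
    · subst hz'
      rw [ringMap_snd h₂.ne]
      unfold ringSnd
      split_ifs
      · rw [hcola, ← hF₁, hF _ _ hf'.1]
      · rw [hcolb, hf.2]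
    rw [ringMap_of_ne hz hz']
  refine ⟨Coloring.mk col ?_⟩
  intro p q hpq
  obtain ⟨i, x, y, h, rfl, rfl⟩ := (twistedRing_adj_iff hk h₁.ne).1 hpq
  rw [key, key]
  split_ifs
  · exact F.valid h
  · exact f.valid h

/-- Potentials on two consecutive copies of a long ring extend to the whole ring. -/
theorem exists_ring_potential {g : ℕ} (hk : k = g + 5) (h₁ : a₁ ≠ b₁)
    (i : ZMod k) (e : Sym2 (ZMod k × W)) (h₀ hₚ : W → ℤ)
    (hr₀ : ∀ z, 0 ≤ h₀ z ∧ h₀ z ≤ g - 1) (hrₚ : ∀ z, 0 ≤ hₚ z ∧ hₚ z ≤ g - 1)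
    (hfst : hₚ a₂ = h₀ (ringFst a₁ b₁ (i - 1))) (hsnd : hₚ b₂ = h₀ (ringSnd a₁ b₁ (i - 1)))
    (hl₀ : ∀ x y, H.Adj x y →
      s(ringMap a₁ b₁ a₂ b₂ i x, ringMap a₁ b₁ a₂ b₂ i y) ≠ e → |h₀ x - h₀ y| ≤ 1)
    (hlₚ : ∀ x y, H.Adj x y →
      s(ringMap a₁ b₁ a₂ b₂ (i - 1) x, ringMap a₁ b₁ a₂ b₂ (i - 1) y) ≠ e → |hₚ x - hₚ y| ≤ 1)
    (he₀ : |h₀ a₂ - h₀ b₂| ≤ 1) (heₚ : |hₚ a₁ - hₚ b₁| ≤ 1) :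
    ∃ h : ZMod k × W → ℤ, (H.twistedRing a₁ b₁ a₂ b₂ k).LipschitzOff e h ∧
      ∀ z, h (ringMap a₁ b₁ a₂ b₂ i z) = h₀ z := by
  classical
  have : NeZero k := ⟨by omega⟩
  -- Starts at `h₀ a₂` for `m = 2` and moves by steps of at most 1 until it stays at `hₚ a₁`. Both
  -- values lie in `[0, g - 1]`, so `k = g + 5` leaves enough room.
  let L : ℕ → ℤ := fun m =>
    max (min (hₚ a₁) (h₀ a₂ + m - 2)) (h₀ a₂ - m + 2)
  -- `m` counts copies from `i`. Layer 1 contains the glued images of `a₂` and `b₂` from copy `i`,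
  -- so it must carry the values of `h₀` there; from layer 2 on, each layer is constant until the
  -- last.
  let hh : ℕ → W → ℤ := fun m z => if m = 0 then h₀ z else if m = k - 1 then hₚ z else
    if m = 1 then (if z = ringSnd a₁ b₁ i then h₀ b₂ else h₀ a₂) else L m
  let h : ZMod k × W → ℤ := fun p => hh (p.1 - i).val p.2
  have hval : ∀ m : ℕ, m < k → ∀ z, h (i + m, z) = hh m z := by
    intro m hm z
    have : (i + (m : ZMod k) - i).val = m := by
      rw [add_sub_cancel_left, ZMod.val_natCast_of_lt hm]
    simp only [h, this]
  have hmap : ∀ m : ℕ, m + 1 < k → ∀ z, h (ringMap a₁ b₁ a₂ b₂ (i + m) z) =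
      if z = a₂ then hh (m + 1) (ringFst a₁ b₁ (i + (m : ZMod k))) else
      if z = b₂ then hh (m + 1) (ringSnd a₁ b₁ (i + (m : ZMod k))) else hh m z := by
    intro m hm z
    unfold ringMap
    split_ifs
    · rw [← hval _ hm]; push_cast; rw [add_assoc]
    · rw [← hval _ hm]; push_cast; rw [add_assoc]
    · exact hval _ (by omega) _
  have hi : ∀ z, h (ringMap a₁ b₁ a₂ b₂ i z) = h₀ z := by
    intro z
    have h0 := hmap 0 (by omega) z
    simp only [Nat.cast_zero, add_zero] at h0
    have := ringFst_ne_ringSnd h₁ i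
    have hk' : ¬ (1 = k - 1) := by omega
    rw [h0]
    simp only [hh]
    split_ifs <;> simp_all
  have hlast : ∀ z, h (ringMap a₁ b₁ a₂ b₂ (i - 1) z) = hₚ z := by
    intro z
    have e1 : i - 1 = i + ((k - 1 : ℕ) : ZMod k) := by
      rw [Nat.cast_sub (by omega)]
      simp [sub_eq_add_neg]
    have hv : ∀ z, h (i - 1, z) = hₚ z := by
      intro z
      rw [e1, hval _ (by omega)]
      have hk' : ¬ (k - 1 = 0) := by omega
      simp [hh, hk']
    have hv0 : ∀ z, h (i, z) = h₀ z := by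
      intro z
      have := hval 0 (by omega) z
      simpa [hh] using this
    unfold ringMap
    split_ifs with hz hz'
    · rw [sub_add_cancel, hv0, hz, hfst]
    · rw [sub_add_cancel, hv0, hz', hsnd]
    · exact hv z
  refine ⟨h, ?_, hi⟩
  intro p q hpq hne
  obtain ⟨j, x, y, hxy, rfl, rfl⟩ := (twistedRing_adj_iff (by omega) h₁).1 hpq
  obtain ⟨m, hm, rfl⟩ : ∃ m : ℕ, m < k ∧ j = i + m :=
    ⟨(j - i).val, ZMod.val_lt _, by simp⟩
  by_cases hm0 : m = 0
  · subst hm0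
    simp only [Nat.cast_zero, add_zero] at hne ⊢
    rw [hi, hi]
    exact hl₀ x y hxy hne
  by_cases hmk : m = k - 1
  · have e1 : i + (m : ZMod k) = i - 1 := by
      rw [hmk, Nat.cast_sub (by omega)]
      simp [sub_eq_add_neg]
    rw [e1] at hne ⊢
    rw [hlast, hlast]
    exact hlₚ x y hxy hne
  have hp := hr₀ a₂
  have hq := hrₚ a₁
  by_cases hm1 : m = 1
  · have hL : L 2 = h₀ a₂ := by simp only [L]; push_cast; omega
    have hval2 : ∀ z, hh 2 z = h₀ a₂ := by
      intro z
      simp only [hh]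
      rw [if_neg (by omega), if_neg (by omega), if_neg (by omega), hL]
    have hv : ∀ z, h (ringMap a₁ b₁ a₂ b₂ (i + m) z) = h₀ a₂ ∨
        h (ringMap a₁ b₁ a₂ b₂ (i + m) z) = h₀ b₂ := by
      intro z
      rw [hmap m (by omega), hm1]
      have hk' : ¬ (1 = k - 1) := by omega
      simp only [hval2]
      simp only [hh]
      split_ifs <;> simp_all
    rw [abs_le] at he₀ ⊢
    rcases hv x with h1 | h1 <;> rcases hv y with h2 | h2 <;> rw [h1, h2] <;> omega
  have hvm : ∀ z, hh m z = L m := by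
    intro z
    simp only [hh]
    rw [if_neg hm0, if_neg hmk, if_neg hm1]
  by_cases hm2 : m = k - 2
  · have hL : L m = hₚ a₁ := by simp only [L]; omega
    have hvm1 : ∀ z, hh (m + 1) z = hₚ z := by
      intro z
      simp only [hh]
      rw [if_neg (by omega), if_pos (by omega)]
    have hv : ∀ z, h (ringMap a₁ b₁ a₂ b₂ (i + m) z) = hₚ a₁ ∨
        h (ringMap a₁ b₁ a₂ b₂ (i + m) z) = hₚ b₁ := by
      intro z
      rw [hmap m (by omega), hvm1, hvm1, hvm, hL]
      unfold ringFst ringSnd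
      split_ifs <;> simp
    rw [abs_le] at heₚ ⊢
    rcases hv x with h1 | h1 <;> rcases hv y with h2 | h2 <;> rw [h1, h2] <;> omega
  have hvm1 : ∀ z, hh (m + 1) z = L (m + 1) := by
    intro z
    simp only [hh]
    rw [if_neg (by omega), if_neg (by omega), if_neg (by omega)]
  have hv : ∀ z, h (ringMap a₁ b₁ a₂ b₂ (i + m) z) = L m ∨
      h (ringMap a₁ b₁ a₂ b₂ (i + m) z) = L (m + 1) := by
    intro z
    rw [hmap m (by omega), hvm1, hvm1, hvm]
    split_ifs <;> simp
  have hLL : -1 ≤ L m - L (m + 1) ∧ L m - L (m + 1) ≤ 1 := by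
    simp only [L]; push_cast; omega
  rw [abs_le]
  rcases hv x with h1 | h1 <;> rcases hv y with h2 | h2 <;> rw [h1, h2] <;> omega

theorem le_egirth_twistedRing {g : ℕ} (hg : 1 ≤ g) (hk : k = g + 5) (hH : (g : ℕ∞) ≤ H.egirth)
    (h₁ : H.Adj a₁ b₁) (h₂ : H.Adj a₂ b₂)
    (ha₁ : a₁ ≠ a₂) (ha₂ : a₁ ≠ b₂) (hb₁ : b₁ ≠ a₂) (hb₂ : b₁ ≠ b₂) :
    (g : ℕ∞) ≤ (H.twistedRing a₁ b₁ a₂ b₂ k).egirth := by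
  classical
  have hk2 : 2 ≤ k := by omega
  have hinj := fun i : ZMod k => ringMap_injective (a₂ := a₂) (b₂ := b₂) hk2 h₁.ne i
  have hsym : ∀ (i : ZMod k) (p q x y : W), s(ringMap a₁ b₁ a₂ b₂ i p, ringMap a₁ b₁ a₂ b₂ i q) =
      s(ringMap a₁ b₁ a₂ b₂ i x, ringMap a₁ b₁ a₂ b₂ i y) ↔ s(p, q) = s(x, y) := by
    intro i p q x y
    simp only [Sym2.eq_iff, (hinj i).eq_iff]
  have hdisj : s(a₂, b₂) ≠ s(a₁, b₁) := by
    simp [ha₁.symm, hb₁.symm]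
  -- A glued edge lies in two copies, so potentials separating its ends are needed in both, matched
  -- at these ends up to the twist.
  have glued : ∀ i : ZMod k, ∃ h, (H.twistedRing a₁ b₁ a₂ b₂ k).LipschitzOff
      s((i, a₁), (i, b₁)) h ∧ h (i, a₁) = 0 ∧ h (i, b₁) = g - 1 := by
    intro i
    obtain ⟨h₀, l₀, x₀, y₀, r₀⟩ := exists_potential hg hH h₁
    have : ∃ hₚ : W → ℤ, H.LipschitzOff s(a₂, b₂) hₚ ∧ hₚ a₂ = h₀ (ringFst a₁ b₁ (i - 1)) ∧
        hₚ b₂ = h₀ (ringSnd a₁ b₁ (i - 1)) ∧ ∀ z, 0 ≤ hₚ z ∧ hₚ z ≤ g - 1 := by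
      unfold ringFst ringSnd
      split_ifs
      · obtain ⟨h, l, x, y, r⟩ := exists_potential hg hH h₂.symm
        exact ⟨h, by rwa [Sym2.eq_swap], by rw [y, y₀], by rw [x, x₀], r⟩
      · obtain ⟨h, l, x, y, r⟩ := exists_potential hg hH h₂
        exact ⟨h, l, by rw [x, x₀], by rw [y, y₀], r⟩
    obtain ⟨hₚ, lₚ, xₚ, yₚ, rₚ⟩ := this
    have k₀ : ∀ x y, H.Adj x y → s(ringMap a₁ b₁ a₂ b₂ i x, ringMap a₁ b₁ a₂ b₂ i y) ≠
        s((i, a₁), (i, b₁)) → |h₀ x - h₀ y| ≤ 1 := by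
      intro x y hxy hne
      refine l₀ x y hxy fun h => hne ?_
      rw [(hsym i x y a₁ b₁).2 h, ringMap_of_ne ha₁ ha₂, ringMap_of_ne hb₁ hb₂]
    have kₚ : ∀ x y, H.Adj x y →
        s(ringMap a₁ b₁ a₂ b₂ (i - 1) x, ringMap a₁ b₁ a₂ b₂ (i - 1) y) ≠
        s((i, a₁), (i, b₁)) → |hₚ x - hₚ y| ≤ 1 := by
      intro x y hxy hne
      refine lₚ x y hxy fun h => hne ?_
      rw [(hsym _ x y a₂ b₂).2 h, ringMap_fst, ringMap_snd h₂.ne, sub_add_cancel]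
      unfold ringFst ringSnd
      split_ifs
      · exact Sym2.eq_swap
      · rfl
    obtain ⟨h, hl, hv⟩ := exists_ring_potential (H := H) hk h₁.ne i
      s((i, a₁), (i, b₁)) h₀ hₚ r₀ rₚ xₚ yₚ k₀ kₚ (l₀ _ _ h₂ hdisj) (lₚ _ _ h₁ hdisj.symm)
    refine ⟨h, hl, ?_, ?_⟩
    · rw [← x₀, ← hv, ringMap_of_ne ha₁ ha₂]
    · rw [← y₀, ← hv, ringMap_of_ne hb₁ hb₂]
  have glued' : ∀ (i : ZMod k) (p q), s(p, q) = s((i, a₁), (i, b₁)) → ∃ h,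
      (H.twistedRing a₁ b₁ a₂ b₂ k).LipschitzOff s(p, q) h ∧ (g : ℤ) - 1 ≤ |h p - h q| := by
    intro i p q hpq
    obtain ⟨h, hl, h0, h1⟩ := glued i
    refine ⟨h, by rwa [hpq], ?_⟩
    rcases Sym2.eq_iff.1 hpq with ⟨rfl, rfl⟩ | ⟨rfl, rfl⟩
    · rw [h0, h1, abs_sub_comm]; simp [le_abs_self]
    · rw [h0, h1]; simp [le_abs_self]
  apply le_egirth_of_potential
  intro p q hpq
  obtain ⟨i, x, y, hxy, rfl, rfl⟩ := (twistedRing_adj_iff hk2 h₁.ne).1 hpq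
  by_cases hc₂ : s(x, y) = s(a₂, b₂)
  · refine glued' (i + 1) _ _ ?_
    rw [(hsym i x y a₂ b₂).2 hc₂, ringMap_fst, ringMap_snd h₂.ne]
    unfold ringFst ringSnd
    split_ifs
    · exact Sym2.eq_swap
    · rfl
  by_cases hc₁ : s(x, y) = s(a₁, b₁)
  · refine glued' i _ _ ?_
    rw [(hsym i x y a₁ b₁).2 hc₁, ringMap_of_ne ha₁ ha₂, ringMap_of_ne hb₁ hb₂]
  obtain ⟨h₀, l₀, x₀, y₀, r₀⟩ := exists_potential hg hH hxy
  have hab := l₀ _ _ h₁ (Ne.symm hc₁)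
  -- An edge that is not glued lies in copy `i` only. The previous copy may then take just the two
  -- values of `h₀` on the shared edge, which differ by at most 1.
  let hₚ : W → ℤ := fun z => if z = a₂ then h₀ (ringFst a₁ b₁ (i - 1)) else
    if z = b₂ then h₀ (ringSnd a₁ b₁ (i - 1)) else h₀ a₁
  have hvₚ : ∀ z, hₚ z = h₀ a₁ ∨ hₚ z = h₀ b₁ := by
    intro z
    simp only [hₚ]
    unfold ringFst ringSnd
    split_ifs <;> simp
  have hlₚ : ∀ x y, |hₚ x - hₚ y| ≤ 1 := by
    intro x y
    rw [abs_le] at hab ⊢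
    rcases hvₚ x with h1 | h1 <;> rcases hvₚ y with h2 | h2 <;> rw [h1, h2] <;> omega
  obtain ⟨h, hl, hv⟩ := exists_ring_potential (H := H) hk h₁.ne i
      s(ringMap a₁ b₁ a₂ b₂ i x, ringMap a₁ b₁ a₂ b₂ i y) h₀ hₚ r₀
      (fun z => by rcases hvₚ z with h | h <;> rw [h] <;> exact r₀ _)
      (by simp [hₚ]) (by simp [hₚ, h₂.ne.symm])
      (fun p q hpq hne => l₀ p q hpq fun h => hne ((hsym i p q x y).2 h))
      (fun p q _ _ => hlₚ p q) (l₀ _ _ h₂ (Ne.symm hc₂)) (hlₚ _ _)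
  refine ⟨h, hl, ?_⟩
  rw [hv, hv, x₀, y₀, abs_sub_comm]
  simp [le_abs_self]

end Ring

theorem chromaticNumber_eq_of_colorable {V W : Type*} {G : SimpleGraph V} {H : SimpleGraph W}
    {c : ℕ} (hH : H.chromaticNumber = c) (hG : G.Colorable c) (f : H →g G) :
    G.chromaticNumber = c :=
  le_antisymm hG.chromaticNumber_le (hH ▸ chromaticNumber_mono_of_hom f)

theorem egirth_eq_of_le {V W : Type*} {G : SimpleGraph V} {H : SimpleGraph W}
    {g : ℕ} (hH : H.egirth = g) (hG : (g : ℕ∞) ≤ G.egirth) (f : H →g G)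
    (hf : Function.Injective f) : G.egirth = g :=
  le_antisymm (hH ▸ IsContained.egirth_le ⟨⟨f, hf⟩⟩) hG

theorem exists_not_scOrientable_of_gadget {g c : ℕ} (hg : 3 ≤ g) {W : Type} [Finite W]
    {H : SimpleGraph W} (hH : H.HasGirthAndChromaticNumber g c) {a₁ b₁ a₂ b₂ : W}
    (h : H.IsCouplingGadget a₁ b₁ a₂ b₂) : ∃ (V : Type) (_ : Finite V) (G : SimpleGraph V),
      G.HasGirthAndChromaticNumber g c ∧ ¬ G.SCOrientable := by
  obtain ⟨hgirth, hchi⟩ := hH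
  obtain ⟨-, h₁, h₂, hc, ⟨σ, -, hσ⟩, ⟨k, hk, f, f', hf, hf'⟩⟩ := h
  obtain rfl : k = c := by
    rw [hchi] at hk
    exact_mod_cast hk.symm
  -- One-vertex paths count, so the absence of paths makes the two edges disjoint.
  have hne : ∀ x ∈ ({a₁, b₁} : Set W), ∀ y ∈ ({a₂, b₂} : Set W), x ≠ y := by
    rintro x hx y hy rfl
    exact hσ x hx x hy ⟨[x], by simp [Digraph.IsPath]⟩
  have ha₁ := hne a₁ (by simp) a₂ (by simp)
  have ha₂ := hne a₁ (by simp) b₂ (by simp)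
  have hb₁ := hne b₁ (by simp) a₂ (by simp)
  have hb₂ := hne b₁ (by simp) b₂ (by simp)
  have : NeZero (g + 5) := ⟨by omega⟩
  let F : H →g H.twistedRing a₁ b₁ a₂ b₂ (g + 5) :=
    ⟨ringMap a₁ b₁ a₂ b₂ 0, fun h => twistedRing_adj (by omega) h₁.ne 0 h⟩
  refine ⟨ZMod (g + 5) × W, inferInstance, H.twistedRing a₁ b₁ a₂ b₂ (g + 5), ⟨?_, ?_⟩, ?_⟩
  · exact egirth_eq_of_le hgirth (le_egirth_twistedRing (by omega) rfl hgirth.ge h₁ h₂ ha₁ ha₂ hb₁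
      hb₂) F (ringMap_injective (by omega) h₁.ne 0)
  · exact chromaticNumber_eq_of_colorable hchi
      (colorable_twistedRing (by omega) h₁ h₂ f f' hf hf') F
  · exact not_scOrientable_twistedRing (by omega) h₁ h₂ ha₁ ha₂ hb₁ hb₂ hc

end SimpleGraph

/-! ### Large girth and large chromatic number by counting sequences of pairs -/

namespace SimpleGraph

section Random

open Finset

/-- Tuples over `α` with prescribed values at `l` distinct positions. -/
theorem card_prescribed_mul_le {α : Type*} [Fintype α] [DecidableEq α] {M l : ℕ}
    {j : Fin l → Fin M} (hj : Function.Injective j) (c : Fin l → α) :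
    #{e : Fin M → α | ∀ i, e (j i) = c i} * Fintype.card α ^ l ≤ Fintype.card α ^ M := by
  classical
  have h1 : Fintype.card α ^ l = #(univ : Finset (Fin l → α)) := by simp
  have h2 : Fintype.card α ^ M = #(univ : Finset (Fin M → α)) := by simp
  rw [h1, h2, ← card_product]
  -- Overwriting the positions `j` of `e` by `d` loses no information, since those entries of `e`
  -- were prescribed.
  refine card_le_card_of_injOn
    (fun p k => if h : ∃ i, j i = k then p.2 h.choose else p.1 k) (by simp) ?_
  rintro ⟨e, d⟩ he ⟨e', d'⟩ he' h
  simp only [coe_product, coe_filter, mem_univ, true_and, Set.mem_prod, Set.mem_ofPred_eq,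
    coe_univ, Set.mem_univ, and_true] at he he'
  have hd : d = d' := by
    funext i
    have hi : ∃ i', j i' = j i := ⟨i, rfl⟩
    have := congrFun h (j i)
    simp only [dif_pos hi] at this
    rwa [hj hi.choose_spec] at this
  have he : e = e' := by
    funext k
    by_cases hk : ∃ i, j i = k
    · obtain ⟨i, rfl⟩ := hk
      rw [he, he']
    · have := congrFun h k
      simpa only [dif_neg hk] using this
  rw [hd, he]

/-- Cauchy–Schwarz for the sizes of the color classes: at least a fraction `1/q` of all pairs is
monochromatic. -/
theorem card_sq_le_mul_card_monochromatic {V : Type*} [Fintype V] {q : ℕ} (f : V → Fin q) :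
    Fintype.card V ^ 2 ≤ q * #{p : V × V | f p.1 = f p.2} := by
  classical
  have h1 : Fintype.card V = ∑ c : Fin q, #{x | f x = c} := by
    rw [← card_univ, card_eq_sum_card_fiberwise (f := f) (t := univ) (by simp)]
  have h2 : #{p : V × V | f p.1 = f p.2} = ∑ c : Fin q, #{x | f x = c} ^ 2 := by
    rw [card_eq_sum_card_fiberwise (f := fun p : V × V => f p.1) (t := univ) (by simp)]
    refine sum_congr rfl fun c _ => ?_
    rw [sq, ← card_product]
    congr 1
    ext p
    simp only [mem_filter, mem_univ, true_and, mem_product]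
    constructor
    · rintro ⟨h, rfl⟩; exact ⟨rfl, h.symm⟩
    · rintro ⟨rfl, h⟩; exact ⟨h.symm, rfl⟩
  have h3 := sq_sum_le_card_mul_sum_sq (s := (univ : Finset (Fin q))) (f := fun c => #{x | f x = c})
  rw [h1, h2]
  simpa using h3

/-- The pairs of consecutive vertices of the closed walk `v` occur, in the directions given by `ε`,
at the distinct positions `j` of the sequence of pairs `e`. -/
def IsCircuitOf {V : Type*} {M l : ℕ} (e : Fin M → V × V)
    (w : (Fin (l + 1) → V) × (Fin (l + 1) → Fin M) × (Fin (l + 1) → Bool)) : Prop :=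
  Function.Injective w.2.1 ∧
    ∀ i, e (w.2.1 i) = if w.2.2 i then (w.1 i, w.1 (i + 1)) else (w.1 (i + 1), w.1 i)

-- Double counting: there are `n^(l+1) * (K n)^(l+1) * 2^(l+1)` candidates `w`, and each is a
-- circuit of at most a fraction `n^(-2(l+1))` of the sequences. So the average number of circuits
-- is bounded independently of `n`.
open Classical in
theorem sum_card_circuits_le {n K l : ℕ} (hn : 0 < n) :
    ∑ e : Fin (K * n) → Fin n × Fin n,
      #{w : (Fin (l + 1) → Fin n) × (Fin (l + 1) → Fin (K * n)) × (Fin (l + 1) → Bool) |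
        IsCircuitOf e w} ≤ (2 * K) ^ (l + 1) * (n ^ 2) ^ (K * n) := by
  have hpos : 0 < (n ^ 2) ^ (l + 1) := by positivity
  refine Nat.le_of_mul_le_mul_right ?_ hpos
  have hswap : ∑ e : Fin (K * n) → Fin n × Fin n,
      #{w : (Fin (l + 1) → Fin n) × (Fin (l + 1) → Fin (K * n)) × (Fin (l + 1) → Bool) |
        IsCircuitOf e w} =
      ∑ w : (Fin (l + 1) → Fin n) × (Fin (l + 1) → Fin (K * n)) × (Fin (l + 1) → Bool),
        #{e : Fin (K * n) → Fin n × Fin n | IsCircuitOf e w} := by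
    simp only [card_filter]
    exact sum_comm
  rw [hswap, sum_mul]
  have hcard : Fintype.card (Fin n × Fin n) = n ^ 2 := by simp [sq]
  calc _ ≤ ∑ w : (Fin (l + 1) → Fin n) × (Fin (l + 1) → Fin (K * n)) × (Fin (l + 1) → Bool),
        (n ^ 2) ^ (K * n) := by
        refine sum_le_sum fun w _ => ?_
        by_cases hw : Function.Injective w.2.1
        · have := card_prescribed_mul_le hw
            (fun i => if w.2.2 i then (w.1 i, w.1 (i + 1)) else (w.1 (i + 1), w.1 i))
          rw [hcard] at this
          simpa only [IsCircuitOf, hw, true_and] using this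
        · simp [IsCircuitOf, hw]
    _ = _ := by
        simp only [sum_const, card_univ, Fintype.card_prod, Fintype.card_fun, Fintype.card_fin,
          Fintype.card_bool, smul_eq_mul]
        rw [mul_pow, mul_pow]
        ring

open Classical in
/-- A sequence of pairs with few short circuits and many monochromatic pairs in each colouring. -/
theorem exists_pairs {m q : ℕ} (hq : 0 < q) : ∃ (n M : ℕ) (e : Fin M → Fin n × Fin n),
    ∀ f : Fin n → Fin q,
      ∑ l : Fin m, #{w : (Fin (l + 1) → Fin n) × (Fin (l + 1) → Fin M) × (Fin (l + 1) → Bool) |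
        IsCircuitOf e w} < #{i | f (e i).1 = f (e i).2} := by
  have hq' : (0 : ℝ) < q := by exact_mod_cast hq
  have hq1 : (1 : ℝ) ≤ q := by exact_mod_cast hq
  set r : ℝ := 1 - 1 / (2 * q) with hr
  have hr0 : 0 ≤ r := by
    have : 1 / (2 * (q : ℝ)) ≤ 1 := by rw [div_le_one (by positivity)]; linarith
    linarith
  have hr1 : r < 1 := by
    have : 0 < 1 / (2 * (q : ℝ)) := by positivity
    linarith
  -- `r` bounds the mean weight of a random pair. This `K` lets `K * n` pairs beat the union bound
  -- over `q ^ n` colorings by a factor `2 ^ n`.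
  obtain ⟨K, hK⟩ := exists_pow_lt_of_lt_one (show (0 : ℝ) < 1 / (2 * q) by positivity) hr1
  set B : ℕ := ∑ l : Fin m, (2 * K) ^ ((l : ℕ) + 1) with hB
  -- The mean of `X / t` is at most `B / (2B + 1) < 1/2`, and `n = t + 1` makes the mean of `Y` at
  -- most `2^t / 2^n = 1/2`.
  obtain ⟨t, ht⟩ : ∃ t, t = 2 * B + 1 := ⟨_, rfl⟩
  obtain ⟨n, hn⟩ : ∃ n, n = t + 1 := ⟨_, rfl⟩
  let X : (Fin (K * n) → Fin n × Fin n) → ℕ := fun e => ∑ l : Fin m,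
    #{w : (Fin (l + 1) → Fin n) × (Fin (l + 1) → Fin (K * n)) × (Fin (l + 1) → Bool) |
        IsCircuitOf e w}
  -- Each summand of `Y e` is `2` to the power `t` minus the number of monochromatic pairs, so `Y e
  -- < 1` forces more than `t` such pairs for every `f` at once.
  let wt : (Fin n → Fin q) → Fin n × Fin n → ℝ := fun f p => if f p.1 = f p.2 then 1 / 2 else 1
  let Y : (Fin (K * n) → Fin n × Fin n) → ℝ := fun e => ∑ f, 2 ^ t * ∏ i, wt f (e i)
  have hn0 : 0 < n := by omega
  have hN : (0 : ℝ) < ((n : ℝ) ^ 2) ^ (K * n) := by positivity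
  have hX : (∑ e, (X e : ℝ)) ≤ B * ((n : ℝ) ^ 2) ^ (K * n) := by
    have : ∑ e, X e ≤ B * (n ^ 2) ^ (K * n) := by
      simp only [X]
      rw [sum_comm, hB, sum_mul]
      exact sum_le_sum fun l _ => sum_card_circuits_le hn0
    exact_mod_cast this
  have hwt : ∀ f, ∑ p, wt f p ≤ (n : ℝ) ^ 2 * r := by
    intro f
    have h1 : ∑ p, wt f p = (n : ℝ) ^ 2 - (#{p : Fin n × Fin n | f p.1 = f p.2} : ℝ) / 2 := by
      have : ∀ p, wt f p = 1 - (if f p.1 = f p.2 then (1 : ℝ) else 0) / 2 := by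
        intro p
        simp only [wt]
        split_ifs <;> norm_num
      simp only [this, sum_sub_distrib, ← sum_div, sum_boole]
      simp [sq]
    have h2 : (n : ℝ) ^ 2 ≤ q * (#{p : Fin n × Fin n | f p.1 = f p.2} : ℝ) := by
      have := card_sq_le_mul_card_monochromatic f
      rw [Fintype.card_fin] at this
      exact_mod_cast this
    have h3 : (n : ℝ) ^ 2 / q ≤ (#{p : Fin n × Fin n | f p.1 = f p.2} : ℝ) := by
      rw [div_le_iff₀ hq']; linarith
    have h4 : (n : ℝ) ^ 2 * r = (n : ℝ) ^ 2 - (n : ℝ) ^ 2 / q / 2 := by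
      rw [hr]; field_simp
    rw [h1, h4]
    linarith
  have hwt0 : ∀ f p, 0 ≤ wt f p := fun f p => by simp only [wt]; split_ifs <;> norm_num
  have hY : ∑ e, Y e ≤ 1 / 2 * ((n : ℝ) ^ 2) ^ (K * n) := by
    simp only [Y]
    rw [sum_comm]
    calc _ ≤ ∑ f : Fin n → Fin q, 2 ^ t * (((n : ℝ) ^ 2) ^ (K * n) * (1 / (2 * q)) ^ n) := by
          refine sum_le_sum fun f _ => ?_
          rw [← mul_sum, ← Fintype.sum_pow]
          gcongr
          calc _ ≤ ((n : ℝ) ^ 2 * r) ^ (K * n) :=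
                pow_le_pow_left₀ (sum_nonneg fun p _ => hwt0 f p) (hwt f) _
            _ = ((n : ℝ) ^ 2) ^ (K * n) * (r ^ K) ^ n := by rw [mul_pow, pow_mul r]
            _ ≤ _ := by gcongr
      _ = 1 / 2 * ((n : ℝ) ^ 2) ^ (K * n) := by
          simp only [sum_const, card_univ, Fintype.card_fun, Fintype.card_fin, nsmul_eq_mul]
          have h2n : (2 : ℝ) ^ n = 2 ^ t * 2 := by rw [hn, pow_succ]
          rw [div_pow, mul_pow, h2n, one_pow]
          push_cast
          field_simp
  have hsum : ∑ e, ((X e : ℝ) / t + Y e) < ∑ e : Fin (K * n) → Fin n × Fin n, (1 : ℝ) := by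
    rw [sum_add_distrib, ← sum_div]
    have h1 : (∑ e : Fin (K * n) → Fin n × Fin n, (1 : ℝ)) = ((n : ℝ) ^ 2) ^ (K * n) := by
      simp [sq]
    have h2 : (∑ e, (X e : ℝ)) / t < 1 / 2 * ((n : ℝ) ^ 2) ^ (K * n) := by
      have ht' : (t : ℝ) = 2 * B + 1 := by rw [ht]; push_cast; ring
      rw [div_lt_iff₀ (by rw [ht']; positivity), ht']
      nlinarith
    rw [h1]
    linarith
  obtain ⟨e, -, he⟩ := exists_lt_of_sum_lt hsum
  have ht0 : (0 : ℝ) < t := by rw [ht]; positivity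
  have hY0 : ∀ f, 0 ≤ 2 ^ t * ∏ i, wt f (e i) := fun f =>
    mul_nonneg (by positivity) (prod_nonneg fun i _ => hwt0 f _)
  have hYe : 0 ≤ Y e := sum_nonneg fun f _ => hY0 f
  have hXt : X e < t := by
    have : (X e : ℝ) / t < 1 := by linarith
    rw [div_lt_one ht0] at this
    exact_mod_cast this
  refine ⟨n, K * n, e, fun f => hXt.trans ?_⟩
  have hf : 2 ^ t * ∏ i, wt f (e i) < 1 := by
    have h1 : 2 ^ t * ∏ i, wt f (e i) ≤ Y e := single_le_sum (fun f _ => hY0 f) (mem_univ f)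
    have h2 : 0 ≤ (X e : ℝ) / t := div_nonneg (Nat.cast_nonneg _) ht0.le
    linarith
  have hprod : ∏ i, wt f (e i) = (1 / 2) ^ #{i | f (e i).1 = f (e i).2} := by
    simp only [wt]
    rw [prod_ite]
    simp
  rw [hprod] at hf
  by_contra! hle
  have h1 : (1 / 2 : ℝ) ^ t ≤ (1 / 2) ^ #{i | f (e i).1 = f (e i).2} :=
    pow_le_pow_of_le_one (by norm_num) (by norm_num) hle
  have h2 : (2 : ℝ) ^ t * (1 / 2) ^ t = 1 := by rw [← mul_pow]; norm_num
  have h3 : (2 : ℝ) ^ t * (1 / 2) ^ t ≤ 2 ^ t * (1 / 2) ^ #{i | f (e i).1 = f (e i).2} := by gcongr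
  linarith

/-- There are finite graphs of arbitrarily large girth and chromatic number. -/
theorem exists_egirth_gt_not_colorable {m q : ℕ} (hm : 0 < m) (hq : 0 < q) :
    ∃ (n : ℕ) (G : SimpleGraph (Fin n)), (m : ℕ∞) < G.egirth ∧ ¬ G.Colorable q := by
  classical
  obtain ⟨n, M, e, he⟩ := exists_pairs (m := m) hq
  -- One position from each circuit of length at most `m` is discarded; the remaining pairs are the
  -- edges.
  let R : Finset (Fin M) := univ.biUnion fun l : Fin m =>
    ({w : (Fin (l + 1) → Fin n) × (Fin (l + 1) → Fin M) × (Fin (l + 1) → Bool) |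
        IsCircuitOf e w} : Finset _).image fun w => w.2.1 0
  have hR : #R ≤ ∑ l : Fin m, #{w : (Fin (l + 1) → Fin n) × (Fin (l + 1) → Fin M) ×
      (Fin (l + 1) → Bool) | IsCircuitOf e w} :=
    card_biUnion_le.trans (sum_le_sum fun l _ => card_image_le)
  have hmem : ∀ (l : ℕ), l < m → ∀ w : (Fin (l + 1) → Fin n) × (Fin (l + 1) → Fin M) ×
      (Fin (l + 1) → Bool), IsCircuitOf e w → w.2.1 0 ∈ R := by
    intro l hl w hw
    exact mem_biUnion.2 ⟨⟨l, hl⟩, mem_univ _, mem_image.2 ⟨w, by simpa using hw, rfl⟩⟩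
  let G : SimpleGraph (Fin n) :=
    { Adj := fun x y => x ≠ y ∧ ∃ i, i ∉ R ∧ (e i = (x, y) ∨ e i = (y, x))
      symm := ⟨fun x y h => ⟨h.1.symm, by obtain ⟨i, hi, h'⟩ := h.2; exact ⟨i, hi, h'.symm⟩⟩⟩
      loopless := ⟨fun x h => h.1 rfl⟩ }
  refine ⟨n, G, ?_, ?_⟩
  · suffices h : ((m + 1 : ℕ) : ℕ∞) ≤ G.egirth from
      lt_of_lt_of_le (by exact_mod_cast Nat.lt_succ_self m) h
    rw [le_egirth]
    intro a w hw
    by_contra! hlt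
    have hlt' : w.length ≤ m := by
      have : w.length < m + 1 := by exact_mod_cast hlt
      omega
    have h3 := hw.three_le_length
    obtain ⟨l, hl⟩ : ∃ l, w.length = l + 1 := ⟨w.length - 1, by omega⟩
    have hnext : ∀ i : Fin (l + 1), w.getVert ((i + 1 : Fin (l + 1)) : ℕ) = w.getVert (i + 1) := by
      intro i
      rcases eq_or_ne i (Fin.last l) with rfl | hi
      · simp [← hl]
      · rw [Fin.val_add_one_of_lt (Fin.lt_last_iff_ne_last.2 hi)]
    have hadj : ∀ i : Fin (l + 1), G.Adj (w.getVert i) (w.getVert (i + 1)) := fun i =>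
      w.adj_getVert_succ (by omega)
    choose hne j hjR hj using hadj
    have hjs : ∀ i, s((e (j i)).1, (e (j i)).2) = s(w.getVert i, w.getVert (i + 1)) := by
      intro i
      rcases hj i with h | h
      · rw [h]
      · rw [h]; exact Sym2.eq_swap
    have hinj : Function.Injective j := by
      intro i i' hii
      have h1 : s(w.getVert i, w.getVert (i + 1)) = s(w.getVert i', w.getVert (i' + 1)) := by
        rw [← hjs, ← hjs, hii]
      have hi : (i : ℕ) < w.edges.length := by rw [Walk.length_edges]; omega
      have hi' : (i' : ℕ) < w.edges.length := by rw [Walk.length_edges]; omega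
      rw [← Walk.getElem_edges hi, ← Walk.getElem_edges hi'] at h1
      exact Fin.ext ((hw.isTrail.edges_nodup.getElem_inj_iff).1 h1)
    refine hjR 0 (hmem l (by omega) (fun i => w.getVert i, j, fun i =>
      decide (e (j i) = (w.getVert i, w.getVert (i + 1)))) ⟨hinj, fun i => ?_⟩)
    simp only [hnext]
    by_cases h : e (j i) = (w.getVert i, w.getVert (i + 1))
    · simp [h]
    · simp only [h, decide_false, Bool.false_eq_true, if_false]
      exact (hj i).resolve_left h
  · rintro ⟨C⟩
    have hlt := hR.trans_lt (he C)
    obtain ⟨i, hi, hiR⟩ := exists_mem_notMem_of_card_lt_card hlt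
    simp only [mem_filter, mem_univ, true_and] at hi
    -- A pair with equal entries is a circuit of length 1, hence discarded because `0 < m`.
    by_cases hxy : (e i).1 = (e i).2
    · refine hiR (hmem 0 hm (fun _ => (e i).1, fun _ => i, fun _ => true)
        ⟨fun a b _ => Subsingleton.elim (α := Fin 1) a b, fun _ => ?_⟩)
      simp [Prod.ext_iff, hxy]
    · exact C.valid (show G.Adj (e i).1 (e i).2 from ⟨hxy, i, hiR, Or.inl rfl⟩) hi

end Random

end SimpleGraph

/-! ### Joining two digraphs by arcs in one direction -/

namespace Digraph

variable {V W : Type*}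

/-- The disjoint union of two digraphs together with arcs `E` from the first to the second. -/
def crossSum (D₁ : Digraph V) (D₂ : Digraph W) (E : V → W → Prop) : Digraph (V ⊕ W) where
  Adj
    | .inl x, .inl y => D₁.Adj x y
    | .inl x, .inr y => E x y
    | .inr _, .inl _ => False
    | .inr x, .inr y => D₂.Adj x y

variable {D₁ : Digraph V} {D₂ : Digraph W} {E : V → W → Prop}

theorem reach_crossSum_inl {x : V} {t : V ⊕ W} (h : (crossSum D₁ D₂ E).Reach (.inl x) t) :
    (∃ t', t = .inl t' ∧ D₁.Reach x t') ∨
      ∃ t', t = .inr t' ∧ ∃ p q, E p q ∧ D₁.Reach x p ∧ D₂.Reach q t' := by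
  induction h with
  | refl => exact .inl ⟨x, rfl, .refl⟩
  | @tail b c _ hbc ih =>
    rcases ih with ⟨t', rfl, h⟩ | ⟨t', rfl, p, q, hpq, hp, hq⟩
    · cases c with
      | inl c => exact .inl ⟨c, rfl, h.tail hbc⟩
      | inr c => exact .inr ⟨c, rfl, t', c, hbc, h, .refl⟩
    · cases c with
      | inl c => exact hbc.elim
      | inr c => exact .inr ⟨c, rfl, p, q, hpq, hp, hq.tail hbc⟩

theorem reach_crossSum_inr {x : W} {t : V ⊕ W} (h : (crossSum D₁ D₂ E).Reach (.inr x) t) :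
    ∃ t', t = .inr t' ∧ D₂.Reach x t' := by
  induction h with
  | refl => exact ⟨x, rfl, .refl⟩
  | @tail b c _ hbc ih =>
    obtain ⟨t', rfl, h⟩ := ih
    cases c with
    | inl c => exact hbc.elim
    | inr c => exact ⟨c, rfl, h.tail hbc⟩

theorem reachAvoiding_crossSum_inl {s x : V} {t : V ⊕ W}
    (h : (crossSum D₁ D₂ E).ReachAvoiding (.inl s) (.inl x) t) :
    (∃ t', t = .inl t' ∧ D₁.ReachAvoiding s x t') ∨
      ∃ t', t = .inr t' ∧ ∃ p q, E p q ∧ D₁.ReachAvoiding s x p ∧ D₂.Reach q t' := by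
  induction h with
  | refl => exact .inl ⟨x, rfl, .refl⟩
  | @tail b c _ hbc ih =>
    rcases ih with ⟨t', rfl, h⟩ | ⟨t', rfl, p, q, hpq, hp, hq⟩
    · cases c with
      | inl c => exact .inl ⟨c, rfl, h.tail ⟨hbc.1, fun e => hbc.2 (e ▸ rfl)⟩⟩
      | inr c => exact .inr ⟨c, rfl, t', c, hbc.1, h, .refl⟩
    · cases c with
      | inl c => exact hbc.1.elim
      | inr c => exact .inr ⟨c, rfl, p, q, hpq, hp, hq.tail hbc.1⟩

theorem reachAvoiding_crossSum_inr {s x : W} {t : V ⊕ W}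
    (h : (crossSum D₁ D₂ E).ReachAvoiding (.inr s) (.inr x) t) :
    ∃ t', t = .inr t' ∧ D₂.ReachAvoiding s x t' := by
  induction h with
  | refl => exact ⟨x, rfl, .refl⟩
  | @tail b c _ hbc ih =>
    obtain ⟨t', rfl, h⟩ := ih
    cases c with
    | inl c => exact hbc.1.elim
    | inr c => exact ⟨c, rfl, h.tail ⟨hbc.1, fun e => hbc.2 (e ▸ rfl)⟩⟩

theorem ReachAvoiding.ne {D : Digraph V} {s x t : V} (h : D.ReachAvoiding s x t) (hx : x ≠ s) :
    t ≠ s := by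
  induction h with
  | refl => exact hx
  | tail _ hbc _ => exact hbc.2

/-- A path crosses at most once. Two crossing paths with the same ends leave at the same tail by
`hE₁` and arrive at the same head by `hE₂`, so uniqueness reduces to the two sides. -/
theorem singlyConnected_crossSum (l₁ : ∀ x, ¬ D₁.Adj x x) (l₂ : ∀ x, ¬ D₂.Adj x x)
    (h₁ : D₁.SinglyConnected) (h₂ : D₂.SinglyConnected)
    (hE₁ : ∀ s p p' q q', E p q → E p' q' → D₁.Reach s p → D₁.Reach s p' → p = p')
    (hE₂ : ∀ t p p' q q', E p q → E p' q' → D₂.Reach q t → D₂.Reach q' t → q = q') :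
    (crossSum D₁ D₂ E).SinglyConnected := by
  have l : ∀ x, ¬ (crossSum D₁ D₂ E).Adj x x := by
    rintro (x | x) h
    · exact l₁ x h
    · exact l₂ x h
  rw [singlyConnected_iff l₁] at h₁
  rw [singlyConnected_iff l₂] at h₂
  rw [singlyConnected_iff l]
  rintro (s | s) (x | x) (y | y) t hx hy hxt hyt
  · rcases reachAvoiding_crossSum_inl hxt with ⟨t', rfl, h⟩ | ⟨t', rfl, p, q, hpq, hp, hq⟩
    · rcases reachAvoiding_crossSum_inl hyt with ⟨t'', e, h'⟩ | ⟨t'', e, -⟩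
      · cases e
        rw [h₁ s x y t' hx hy h h']
      · cases e
    · rcases reachAvoiding_crossSum_inl hyt with ⟨t'', e, -⟩ | ⟨t'', e, p', q', hpq', hp', hq'⟩
      · cases e
      · have : p = p' := hE₁ s p p' q q' hpq hpq' (.head hx hp.reach) (.head hy hp'.reach)
        subst this
        rw [h₁ s x y p hx hy hp hp']
  · obtain ⟨t', rfl, hy'⟩ := reach_crossSum_inr hyt.reach
    rcases reachAvoiding_crossSum_inl hxt with ⟨t'', e, -⟩ | ⟨t'', e, p, q, hpq, hp, hq⟩
    · cases e
    · have h := hE₁ s s p y q hy hpq .refl (.head hx hp.reach)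
      exact absurd h.symm (hp.ne (by rintro rfl; exact l₁ _ hx))
  · obtain ⟨t', rfl, hx'⟩ := reach_crossSum_inr hxt.reach
    rcases reachAvoiding_crossSum_inl hyt with ⟨t'', e, -⟩ | ⟨t'', e, p, q, hpq, hp, hq⟩
    · cases e
    · have h := hE₁ s s p x q hx hpq .refl (.head hy hp.reach)
      exact absurd h.symm (hp.ne (by rintro rfl; exact l₁ _ hy))
  · obtain ⟨t', rfl, hx'⟩ := reach_crossSum_inr hxt.reach
    obtain ⟨t'', e, hy'⟩ := reach_crossSum_inr hyt.reach
    cases e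
    rw [hE₂ t' s s x y hx hy hx' hy']
  · exact hx.elim
  · exact hx.elim
  · exact hy.elim
  · obtain ⟨t', rfl, hx'⟩ := reachAvoiding_crossSum_inr hxt
    obtain ⟨t'', e, hy'⟩ := reachAvoiding_crossSum_inr hyt
    cases e
    rw [h₂ s x y t' hx hy hx' hy']

theorem Orients.sum {G : SimpleGraph V} {H : SimpleGraph W} (h₁ : D₁.Orients G)
    (h₂ : D₂.Orients H) : (crossSum D₁ D₂ fun _ _ => False).Orients (G ⊕g H) where
  adj {x y} h := by
    rcases x with x | x <;> rcases y with y | y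
    · exact h₁.adj h
    · exact h.elim
    · exact h.elim
    · exact h₂.adj h
  total {x y} h := by
    rcases x with x | x <;> rcases y with y | y
    · exact h₁.total h
    · simp at h
    · simp at h
    · exact h₂.total h
  asymm {x y} h := by
    rcases x with x | x <;> rcases y with y | y
    · exact h₁.asymm h
    · exact h.elim
    · exact h.elim
    · exact h₂.asymm h

theorem SinglyConnected.sum {G : SimpleGraph V} {H : SimpleGraph W} (o₁ : D₁.Orients G)
    (o₂ : D₂.Orients H) (h₁ : D₁.SinglyConnected) (h₂ : D₂.SinglyConnected) :
    (crossSum D₁ D₂ fun _ _ => False).SinglyConnected :=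
  singlyConnected_crossSum o₁.irrefl o₂.irrefl h₁ h₂ (fun _ _ _ _ _ h => h.elim)
    fun _ _ _ _ _ h => h.elim

end Digraph

/-! ### Sc-orientable graphs with prescribed girth and chromatic number -/

namespace SimpleGraph

variable {V W : Type*} {G : SimpleGraph V}

theorem le_egirth_sum {g : ℕ} (hg : 1 ≤ g) {H : SimpleGraph W} (hG : (g : ℕ∞) ≤ G.egirth)
    (hH : (g : ℕ∞) ≤ H.egirth) : (g : ℕ∞) ≤ (G ⊕g H).egirth := by
  apply le_egirth_of_potential
  rintro (x | x) (y | y) hxy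
  · rw [sum_adj_inl] at hxy
    obtain ⟨h, hl, hx, hy, -⟩ := exists_potential hg hG hxy
    refine ⟨Sum.elim h fun _ => 0, ?_, ?_⟩
    · rintro (p | p) (q | q) hpq hne
      · exact hl p q (sum_adj_inl.1 hpq) (fun e => hne (by simpa using e))
      · simp at hpq
      · simp at hpq
      · simp
    · simp only [Sum.elim_inl, hx, hy]
      rw [abs_sub_comm]; simp [le_abs_self]
  · simp at hxy
  · simp at hxy
  · rw [sum_adj_inr] at hxy
    obtain ⟨h, hl, hx, hy, -⟩ := exists_potential hg hH hxy
    refine ⟨Sum.elim (fun _ => 0) h, ?_, ?_⟩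
    · rintro (p | p) (q | q) hpq hne
      · simp
      · simp at hpq
      · simp at hpq
      · exact hl p q (sum_adj_inr.1 hpq) (fun e => hne (by simpa using e))
    · simp only [Sum.elim_inr, hx, hy]
      rw [abs_sub_comm]; simp [le_abs_self]

theorem SCOrientable.sum {H : SimpleGraph W} (hG : G.SCOrientable) (hH : H.SCOrientable) :
    (G ⊕g H).SCOrientable := by
  rw [scOrientable_iff] at *
  obtain ⟨D₁, o₁, s₁⟩ := hG
  obtain ⟨D₂, o₂, s₂⟩ := hH
  exact ⟨_, o₁.sum o₂, .sum o₁ o₂ s₁ s₂⟩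

/-- Orienting edges along the order of colours is an sc-orientation if the girth is large. -/
theorem scOrientable_of_colorable {c : ℕ} (hc : 1 ≤ c) (h : G.Colorable c)
    (hG : ((2 * c : ℕ) : ℕ∞) ≤ G.egirth) : G.SCOrientable := by
  obtain ⟨C⟩ := h
  let D : Digraph V := ⟨fun x y => G.Adj x y ∧ C x < C y⟩
  have hD : D.Orients G := by
    refine ⟨fun h => h.1, fun {x y} h => ?_, fun h h' => lt_asymm h.2 h'.2⟩
    exact (lt_or_gt_of_ne (C.valid h)).imp (fun h' => ⟨h, h'⟩) fun h' => ⟨h.symm, h'⟩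
  refine scOrientable_iff.2 ⟨D, hD, (Digraph.singlyConnected_iff hD.irrefl).2 ?_⟩
  intro s x y t hx hy hxt hyt
  by_contra hne
  -- Colors increase along arcs, so paths from `s` have at most `c - 1` arcs. Two paths to `t` with
  -- different first arcs would let the potential rise from `s` to `x` by `2c - 1` along at most `2c
  -- - 3` edges other than `sx`.
  obtain ⟨h, hl, h0, h1, -⟩ := exists_potential (by omega) hG hx.1
  have key : ∀ z t, z ≠ s → D.ReachAvoiding s z t →
      |h z - h t| ≤ ((C t : ℕ) : ℤ) - ((C z : ℕ) : ℤ) := by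
    intro z t hz hzt
    have : |h z - h t| ≤ ((C t : ℕ) : ℤ) - ((C z : ℕ) : ℤ) ∧ t ≠ s := by
      induction hzt with
      | refl => simp [hz]
      | @tail b d _ hbd ih =>
        refine ⟨?_, hbd.2⟩
        have h3 : s(b, d) ≠ s(s, x) := by
          rw [Ne, Sym2.eq_iff]
          rintro (⟨rfl, -⟩ | ⟨-, rfl⟩)
          · exact ih.2 rfl
          · exact hbd.2 rfl
        have h4 := hl b d hbd.1.1 h3
        have h5 : (C b : ℕ) < C d := hbd.1.2
        have h6 := _root_.abs_sub_le (h z) (h b) (h d)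
        omega
    exact this.1
  have k1 := key x t (by rintro rfl; exact hD.irrefl _ hx) hxt
  have k2 := key y t (by rintro rfl; exact hD.irrefl _ hy) hyt
  have k3 := hl s y hy.1 (by
    rw [Ne, Sym2.eq_iff]
    rintro (⟨-, rfl⟩ | ⟨rfl, -⟩)
    · exact hne rfl
    · exact hD.irrefl _ hx)
  have c1 : (C s : ℕ) < C x := hx.2
  have c2 : (C s : ℕ) < C y := hy.2
  have c3 := (C t).2
  rw [abs_le] at k1 k2 k3
  push_cast at h1
  omega

/-- Any `c` classes of an optimal coloring induce a `c`-chromatic graph: with fewer colors on them,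
the whole coloring could be improved. -/
theorem exists_induce_chromaticNumber_eq [Finite V] {c : ℕ} (hc : 1 ≤ c)
    (h : ¬ G.Colorable (c - 1)) : ∃ s : Set V, (G.induce s).chromaticNumber = c := by
  classical
  have := Fintype.ofFinite V
  have hex : ∃ N, G.Colorable N := ⟨_, G.colorable_of_fintype⟩
  obtain ⟨C⟩ := Nat.find_spec hex
  set N := Nat.find hex with hN
  have hcN : c ≤ N := by
    by_contra! hlt
    exact h (Colorable.mono (by omega) ⟨C⟩)
  refine ⟨{v | (C v : ℕ) < c}, ?_⟩
  have h1 : (G.induce {v | (C v : ℕ) < c}).Colorable c :=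
    ⟨Coloring.mk (fun v => (⟨C v.1, v.2⟩ : Fin c)) fun {v w} hvw e =>
      C.valid hvw (Fin.ext (by simpa using e))⟩
  refine le_antisymm h1.chromaticNumber_le ?_
  by_contra! hlt
  have h2 : (G.induce {v | (C v : ℕ) < c}).Colorable (c - 1) := by
    rw [← chromaticNumber_le_iff_colorable]
    have : ((c : ℕ) : ℕ∞) = ((c - 1 : ℕ) : ℕ∞) + 1 := by
      exact_mod_cast (by omega : c = c - 1 + 1)
    rw [this] at hlt
    exact ENat.lt_add_one_iff (ENat.natCast_ne_top _) |>.1 hlt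
  obtain ⟨C'⟩ := h2
  have h3 : G.Colorable (N - 1) := by
    -- Color `c - 1` becomes free, so the classes from `c` on shift down by one.
    refine ⟨Coloring.mk (fun v => if hv : (C v : ℕ) < c then
      (⟨C' ⟨v, hv⟩, by have := (C' ⟨v, hv⟩).2; omega⟩ : Fin (N - 1)) else
      ⟨C v - 1, by have := (C v).2; omega⟩) ?_⟩
    intro v w hvw
    have hval := C.valid hvw
    split_ifs with hv hw hw
    · intro e
      refine C'.valid (show (G.induce {v | (C v : ℕ) < c}).Adj ⟨v, hv⟩ ⟨w, hw⟩ from hvw) ?_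
      exact Fin.ext (by simpa using e)
    · intro e
      have e' : ((C' ⟨v, hv⟩ : Fin (c - 1)) : ℕ) = C w - 1 := by simpa using e
      have := (C' ⟨v, hv⟩).2
      omega
    · intro e
      have e' : (C v : ℕ) - 1 = ((C' ⟨w, hw⟩ : Fin (c - 1)) : ℕ) := by simpa using e
      have := (C' ⟨w, hw⟩).2
      omega
    · intro e
      have e' : (C v : ℕ) - 1 = C w - 1 := by simpa using e
      exact hval (Fin.ext (by omega))
  exact Nat.find_min hex (m := N - 1) (by omega) h3

theorem scOrientable_cycleGraph (n : ℕ) : (cycleGraph (n + 3)).SCOrientable := by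
  let D : Digraph (Fin (n + 3)) := ⟨fun x y => y = x + 1⟩
  have hD : D.Orients (cycleGraph (n + 3)) := by
    refine ⟨fun {x y} h => ?_, fun {x y} h => ?_, fun {x y} h h' => ?_⟩
    · rw [cycleGraph_adj]
      right
      rw [show y = x + 1 from h]
      simp
    · rw [cycleGraph_adj] at h
      rcases h with h | h
      · exact .inr (show x = y + 1 by rw [← h]; simp)
      · exact .inl (show y = x + 1 by rw [← h]; simp)
    · have h1 : x + (1 + 1) = x := by
        rw [← add_assoc, ← show y = x + 1 from h]
        exact (show x = y + 1 from h').symm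
      have h2 : (1 + 1 : Fin (n + 3)) = 0 := by simpa using h1
      have h3 := congrArg Fin.val h2
      simp [Fin.val_add, Nat.mod_eq_of_lt] at h3
  refine scOrientable_iff.2 ⟨D, hD, (Digraph.singlyConnected_iff hD.irrefl).2 ?_⟩
  intro s x y t hx hy _ _
  -- In the cyclic orientation every vertex has a single out-neighbour.
  exact (show x = s + 1 from hx).trans (show y = s + 1 from hy).symm

theorem egirth_cycleGraph (n : ℕ) : (cycleGraph (n + 3)).egirth = (n + 3 : ℕ) := by
  refine le_antisymm ?_ ?_
  · have := egirth_le_length (cycleGraph.isCycle_cycle (n := n))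
    rwa [cycleGraph.length_cycle] at this
  · have key : ∀ x : Fin (n + 3), ∃ h, (cycleGraph (n + 3)).LipschitzOff s(x, x + 1) h ∧
        ((n + 3 : ℕ) : ℤ) - 1 ≤ |h x - h (x + 1)| := by
      intro x
      have step : ∀ z, z ≠ x → |(((z - (x + 1) : Fin (n + 3)) : ℕ) : ℤ) -
          (((z + 1 - (x + 1) : Fin (n + 3)) : ℕ) : ℤ)| ≤ 1 := by
        intro z hz
        have h1 : z + 1 - (x + 1) = (z - (x + 1)) + 1 := by abel
        have h2 : z - (x + 1) ≠ Fin.last (n + 2) := by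
          intro e
          apply hz
          have : z - x = Fin.last (n + 2) + 1 := by rw [← e]; abel
          rw [Fin.last_add_one] at this
          exact sub_eq_zero.1 this
        rw [h1, Fin.val_add_one_of_lt (Fin.lt_last_iff_ne_last.2 h2)]
        push_cast
        simp
      -- Position on the cycle counted from `x + 1`; only the edge from `x` to `x + 1` wraps around.
      refine ⟨fun z => ((z - (x + 1) : Fin (n + 3)) : ℕ), ?_, ?_⟩
      · intro p q hpq hne
        rw [cycleGraph_adj] at hpq
        rcases hpq with h | h
        · obtain rfl : p = q + 1 := by rw [← h]; simp
          rw [abs_sub_comm]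
          exact step q fun e => hne (by rw [e, Sym2.eq_swap])
        · obtain rfl : q = p + 1 := by rw [← h]; simp
          exact step p fun e => hne (by rw [e])
      · have h1 : x - (x + 1) = Fin.last (n + 2) := by
          have : Fin.last (n + 2) + 1 = 0 := Fin.last_add_one _
          rw [eq_neg_of_add_eq_zero_left this]
          abel
        simp only [h1, sub_self]
        simp
        rw [abs_of_nonneg (by positivity)]
        linarith
    apply le_egirth_of_potential
    intro x y hxy
    rw [cycleGraph_adj] at hxy
    rcases hxy with h | h
    · obtain rfl : x = y + 1 := by rw [← h]; simp
      obtain ⟨h, h1, h2⟩ := key y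
      exact ⟨h, by rwa [Sym2.eq_swap], by rwa [abs_sub_comm]⟩
    · obtain rfl : y = x + 1 := by rw [← h]; simp
      exact key x

theorem colorable_cycleGraph (n : ℕ) : (cycleGraph (n + 3)).Colorable 3 :=
  (cycleGraph.tricoloring (n + 3) (by omega)).colorable

/-- There are sc-orientable graphs of every girth and chromatic number. -/
theorem exists_scOrientable {g c : ℕ} (hg : 3 ≤ g) (hc : 3 ≤ c) :
    ∃ (V : Type) (_ : Finite V) (G : SimpleGraph V),
      G.HasGirthAndChromaticNumber g c ∧ G.SCOrientable := by
  -- Girth at least `g` keeps the union with the cycle in the class, and girth at least `2 * c`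
  -- allows orienting by colors.
  obtain ⟨n, E, hE, hE'⟩ := exists_egirth_gt_not_colorable (m := g + 2 * c) (q := c - 1)
    (by omega) (by omega)
  obtain ⟨s, hs⟩ := exists_induce_chromaticNumber_eq (by omega) hE'
  have hE2 : ((g + 2 * c : ℕ) : ℕ∞) ≤ (E.induce s).egirth :=
    hE.le.trans (IsContained.egirth_le ⟨(Embedding.induce s).toCopy⟩)
  obtain ⟨k, rfl⟩ : ∃ k, g = k + 3 := ⟨g - 3, by omega⟩
  have hcol : (E.induce s).Colorable c := chromaticNumber_le_iff_colorable.1 hs.le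
  refine ⟨s ⊕ Fin (k + 3), inferInstance, E.induce s ⊕g cycleGraph (k + 3), ⟨?_, ?_⟩, ?_⟩
  · refine egirth_eq_of_le (egirth_cycleGraph k) (le_egirth_sum (by omega) ?_
      (egirth_cycleGraph k).ge) Embedding.sumInr.toHom Sum.inr_injective
    exact le_trans (by exact_mod_cast Nat.le_add_right _ _) hE2
  · exact chromaticNumber_eq_of_colorable hs (colorable_sum.2 ⟨hcol,
      (colorable_cycleGraph k).mono hc⟩) Embedding.sumInl.toHom
  · refine .sum (scOrientable_of_colorable (by omega) hcol ?_) (scOrientable_cycleGraph k)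
    exact le_trans (by exact_mod_cast Nat.le_add_left _ _) hE2

end SimpleGraph

/-! ### Seeds: the critical edge of a step-by-step subdivision -/

namespace SimpleGraph

/-- A graph `R` such that `R` with an edge `uv` is not sc-orientable, while `R` with a path
`u w v` is. -/
structure IsSeed {X : Type*} (R : SimpleGraph X) (u v w : X) (g c : ℕ) : Prop where
  ne_uv : u ≠ v
  ne_uw : u ≠ w
  ne_vw : v ≠ w
  isolated : ∀ x, ¬ R.Adj w x
  not_adj : ¬ R.Adj u v
  le_egirth : (g : ℕ∞) ≤ (R ⊔ edge u v).egirth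
  colorable : (R ⊔ edge u v).Colorable c
  not_scOrientable : ¬ (R ⊔ edge u v).SCOrientable
  scOrientable : (R ⊔ edge u w ⊔ edge w v).SCOrientable

section Subdivide

variable {V : Type*}

/-- The graph obtained by subdividing the edges in `F`. -/
def subdivide (G : SimpleGraph V) (F : Set (Sym2 V)) : SimpleGraph (V ⊕ Sym2 V) where
  Adj
    | .inl x, .inl y => G.Adj x y ∧ s(x, y) ∉ F
    | .inl x, .inr e => e ∈ F ∧ e ∈ G.edgeSet ∧ x ∈ e
    | .inr e, .inl x => e ∈ F ∧ e ∈ G.edgeSet ∧ x ∈ e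
    | .inr _, .inr _ => False
  symm := ⟨by
    rintro (x | x) (y | y) h
    · exact ⟨h.1.symm, by rw [Sym2.eq_swap]; exact h.2⟩
    · exact h
    · exact h
    · exact h⟩
  loopless := ⟨by
    rintro (x | x) h
    · exact G.irrefl h.1
    · exact h⟩

variable {G : SimpleGraph V} {F : Set (Sym2 V)}

theorem le_egirth_subdivide {g : ℕ} (hg : 1 ≤ g) (hG : (g : ℕ∞) ≤ G.egirth) :
    (g : ℕ∞) ≤ (G.subdivide F).egirth := by
  have key : ∀ x y, G.Adj x y → ∃ h : V ⊕ Sym2 V → ℤ, h (.inl x) = 0 ∧ h (.inl y) = g - 1 ∧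
      h (.inr s(x, y)) = g - 1 ∧
      (∀ p q, G.Adj p q → s(p, q) ≠ s(x, y) → |h (.inl p) - h (.inl q)| ≤ 1) ∧
      ∀ p e, e ∈ G.edgeSet → p ∈ e → (p = x → e ≠ s(x, y)) → |h (.inl p) - h (.inr e)| ≤ 1 := by
    intro x y hxy
    obtain ⟨h, hl, hx, hy, hr⟩ := exists_potential hg hG hxy
    -- A subdivision vertex gets the larger value of its two ends. For the edge `xy` itself the
    -- whole jump of `g - 1` then occurs between `x` and the subdivision vertex.
    refine ⟨Sum.elim h (Sym2.lift ⟨fun p q => max (h p) (h q), fun p q => max_comm _ _⟩),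
      hx, hy, ?_, fun p q hpq hne => hl p q hpq hne, ?_⟩
    · simp only [Sum.elim_inr, Sym2.lift_mk, hx, hy]
      exact max_eq_right (by omega)
    · intro p e he hp hne
      obtain ⟨q, rfl⟩ := hp
      simp only [Sum.elim_inl, Sum.elim_inr, Sym2.lift_mk]
      by_cases hpq : s(p, q) = s(x, y)
      · rcases Sym2.eq_iff.1 hpq with ⟨rfl, rfl⟩ | ⟨rfl, rfl⟩
        · exact absurd rfl (hne rfl)
        · rw [max_eq_left (by rw [hx]; exact (hr _).1)]; simp
      · have := hl p q he hpq
        rw [abs_le] at this ⊢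
        omega
  have sub : ∀ x e, e ∈ F → e ∈ G.edgeSet → x ∈ e → ∃ h, (G.subdivide F).LipschitzOff
      s(.inl x, .inr e) h ∧ (g : ℤ) - 1 ≤ |h (.inl x) - h (.inr e)| := by
    rintro x e heF he ⟨y, rfl⟩
    obtain ⟨h, hx, hy, hxy, h1, h2⟩ := key x y he
    refine ⟨h, ?_, by rw [hx, hxy, abs_sub_comm]; simp [le_abs_self]⟩
    have hinr : ∀ p e', (G.subdivide F).Adj (.inl p) (.inr e') →
        s((.inl p : V ⊕ Sym2 V), .inr e') ≠ s(.inl x, .inr s(x, y)) →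
        |h (.inl p) - h (.inr e')| ≤ 1 := by
      intro p e' hp hne
      exact h2 p e' hp.2.1 hp.2.2 (by rintro rfl rfl; exact hne rfl)
    rintro (p | p) (q | q) hpq hne
    · exact h1 p q hpq.1 (by rintro hpq'; exact hpq.2 (hpq' ▸ heF))
    · exact hinr p q hpq hne
    · rw [abs_sub_comm]
      exact hinr q p hpq.symm (by rwa [Sym2.eq_swap])
    · exact hpq.elim
  apply le_egirth_of_potential
  rintro (x | x) (y | y) hxy
  · obtain ⟨h, hx, hy, -, h1, h2⟩ := key x y hxy.1
    refine ⟨h, ?_, by rw [hx, hy, abs_sub_comm]; simp [le_abs_self]⟩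
    have hinr : ∀ p e, (G.subdivide F).Adj (.inl p) (.inr e) → |h (.inl p) - h (.inr e)| ≤ 1 := by
      intro p e hp
      refine h2 p e hp.2.1 hp.2.2 ?_
      rintro - rfl
      exact hxy.2 hp.1
    rintro (p | p) (q | q) hpq hne
    · exact h1 p q hpq.1 (fun e => hne (by simpa using e))
    · exact hinr p q hpq
    · rw [abs_sub_comm]
      exact hinr q p hpq.symm
    · exact hpq.elim
  · exact sub x y hxy.1 hxy.2.1 hxy.2.2
  · obtain ⟨h, h1, h2⟩ := sub y x hxy.1 hxy.2.1 hxy.2.2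
    exact ⟨h, by rwa [Sym2.eq_swap], by rwa [abs_sub_comm]⟩
  · exact hxy.elim

theorem colorable_subdivide {c : ℕ} (hc : 3 ≤ c) (hG : G.Colorable c) :
    (G.subdivide F).Colorable c := by
  obtain ⟨C⟩ := hG
  have : ∀ e : Sym2 V, ∃ a : Fin c, ∀ x ∈ e, C x ≠ a := by
    intro e
    induction e with
    | _ x y =>
      have hcard : ({C x, C y} : Finset (Fin c)).card < (Finset.univ : Finset (Fin c)).card := by
        refine lt_of_le_of_lt Finset.card_le_two ?_
        rw [Finset.card_univ, Fintype.card_fin]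
        exact hc
      obtain ⟨a, -, ha⟩ := Finset.exists_mem_notMem_of_card_lt_card hcard
      simp only [Finset.mem_insert, Finset.mem_singleton, not_or] at ha
      refine ⟨a, fun z hz => ?_⟩
      rcases Sym2.mem_iff.1 hz with rfl | rfl
      · exact Ne.symm ha.1
      · exact Ne.symm ha.2
  choose f hf using this
  refine ⟨Coloring.mk (Sum.elim C f) ?_⟩
  rintro (x | x) (y | y) h
  · exact C.valid h.1
  · exact hf y x h.2.2
  · exact (hf x y h.2.2).symm
  · exact h.elim

/-- Directing every edge towards its subdivision vertex leaves no directed path with two arcs. -/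
theorem scOrientable_subdivide_univ : (G.subdivide Set.univ).SCOrientable := by
  let D : Digraph (V ⊕ Sym2 V) :=
    ⟨fun p q => (G.subdivide Set.univ).Adj p q ∧ p.isLeft = true⟩
  have hright : ∀ {p q}, D.Adj p q → q.isRight = true := by
    rintro (p | p) (q | q) h
    · exact absurd (Set.mem_univ _) h.1.2
    · rfl
    · exact absurd h.2 (by simp)
    · rfl
  have hno : ∀ {p q r}, D.Adj p q → ¬ D.Adj q r := by
    intro p q r h h'
    have h1 := hright h
    have h2 := h'.2
    cases q <;> simp at h1 h2
  have hD : D.Orients (G.subdivide Set.univ) := by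
    refine ⟨fun h => h.1, ?_, fun h h' => hno h h'⟩
    rintro (p | p) (q | q) h
    · exact absurd (Set.mem_univ _) h.2
    · exact .inl ⟨h, rfl⟩
    · exact .inr ⟨h.symm, rfl⟩
    · exact h.elim
  refine scOrientable_iff.2 ⟨D, hD, (Digraph.singlyConnected_iff hD.irrefl).2 ?_⟩
  intro s x y t hx hy hxt hyt
  have key : ∀ z, D.Adj s z → D.ReachAvoiding s z t → z = t := by
    intro z hz hzt
    rcases Relation.ReflTransGen.cases_head hzt with h | ⟨r, h, -⟩
    · exact h
    · exact absurd h.1 (hno hz)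
  rw [key x hx hxt, key y hy hyt]

theorem exists_isSeed [Finite V] {g c : ℕ} (hg : 1 ≤ g) (hc : 3 ≤ c)
    (hgirth : (g : ℕ∞) ≤ G.egirth) (hcol : G.Colorable c) (hsc : ¬ G.SCOrientable) :
    ∃ (R : SimpleGraph (V ⊕ Sym2 V)) (u v w : V ⊕ Sym2 V), R.IsSeed u v w g c := by
  classical
  have := Fintype.ofFinite V
  -- Subdividing nothing leaves a non-sc-orientable graph and subdividing everything does not, so
  -- some single step changes the answer. The seed is the graph just before it with `e` removed, and
  -- `w` is the still isolated subdivision vertex of `e`.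
  have hex : ∃ (F : Finset (Sym2 V)) (e : Sym2 V), e ∉ F ∧
      ¬ (G.subdivide (F : Set (Sym2 V))).SCOrientable ∧
      (G.subdivide (insert e F : Finset (Sym2 V))).SCOrientable := by
    by_contra! hcon
    have : ∀ F : Finset (Sym2 V), ¬ (G.subdivide (F : Set (Sym2 V))).SCOrientable := by
      intro F
      induction F using Finset.induction_on with
      | empty =>
        intro h
        exact hsc (h.of_injective Sum.inl_injective fun x y hxy => ⟨hxy, by simp⟩)
      | insert e F he ih => exact hcon F e he ih
    refine this Finset.univ ?_
    rw [Finset.coe_univ]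
    exact scOrientable_subdivide_univ
  obtain ⟨F, e, he, hF, hF'⟩ := hex
  have heG : e ∈ G.edgeSet := by
    by_contra hne
    refine hF (hF'.of_injective Function.injective_id ?_)
    rintro (x | x) (y | y) h
    · refine ⟨h.1, fun hmem => ?_⟩
      rcases Finset.mem_insert.1 (Finset.mem_coe.1 hmem) with h' | h'
      · exact hne (h' ▸ h.1)
      · exact h.2 h'
    · exact ⟨Finset.mem_insert_of_mem h.1, h.2⟩
    · exact ⟨Finset.mem_insert_of_mem h.1, h.2⟩
    · exact h.elim
  induction e with
  | _ a b =>
  have hab : a ≠ b := G.ne_of_adj heG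
  have hQ : (G.deleteEdges {s(a, b)}).subdivide (F : Set (Sym2 V)) ⊔ edge (.inl a) (.inl b) =
      G.subdivide (F : Set (Sym2 V)) := by
    ext p q
    rcases p with x | x <;> rcases q with y | y
    · simp only [sup_adj, edge_adj, subdivide, deleteEdges_adj, Set.mem_singleton_iff,
        Sum.inl.injEq, ne_eq]
      constructor
      · rintro (⟨⟨h1, -⟩, h2⟩ | ⟨⟨rfl, rfl⟩ | ⟨rfl, rfl⟩, -⟩)
        · exact ⟨h1, h2⟩
        · exact ⟨heG, he⟩
        · exact ⟨Adj.symm heG, by rw [Sym2.eq_swap]; exact he⟩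
      · rintro ⟨h1, h2⟩
        by_cases h : s(x, y) = s(a, b)
        · exact .inr ⟨Sym2.eq_iff.1 h, h1.ne⟩
        · exact .inl ⟨⟨h1, h⟩, h2⟩
    · simp only [sup_adj, edge_adj, subdivide, edgeSet_deleteEdges, Set.mem_sdiff,
        Set.mem_singleton_iff, reduceCtorEq, and_false, false_and, or_false]
      constructor
      · rintro ⟨h1, h2, h3⟩
        exact ⟨h1, h2.1, h3⟩
      · rintro ⟨h1, h2, h3⟩
        exact ⟨h1, ⟨h2, by rintro rfl; exact he h1⟩, h3⟩
    · simp only [sup_adj, edge_adj, subdivide, edgeSet_deleteEdges, Set.mem_sdiff,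
        Set.mem_singleton_iff, reduceCtorEq, false_and, or_false]
      constructor
      · rintro ⟨h1, h2, h3⟩
        exact ⟨h1, h2.1, h3⟩
      · rintro ⟨h1, h2, h3⟩
        exact ⟨h1, ⟨h2, by rintro rfl; exact he h1⟩, h3⟩
    · simp [sup_adj, edge_adj, subdivide]
  refine ⟨(G.deleteEdges {s(a, b)}).subdivide (F : Set (Sym2 V)), .inl a, .inl b, .inr s(a, b),
    ⟨by simpa using hab, by simp, by simp, ?_, ?_, ?_, ?_, ?_, ?_⟩⟩
  · rintro (x | x) h
    · simpa using h.2.1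
    · exact h
  · intro h
    simpa using h.1
  · rw [hQ]
    exact le_egirth_subdivide hg hgirth
  · rw [hQ]
    exact colorable_subdivide hc hcol
  · rwa [hQ]
  · refine hF'.of_injective Function.injective_id ?_
    have hsub : ∀ x, x ∈ s(a, b) →
        (G.subdivide (insert s(a, b) F : Finset (Sym2 V))).Adj (.inl x) (.inr s(a, b)) :=
      fun x hx => ⟨by simp, heG, hx⟩
    intro p q h
    rw [sup_adj, sup_adj, edge_adj, edge_adj] at h
    simp only [id]
    rcases h with (h | ⟨⟨rfl, rfl⟩ | ⟨rfl, rfl⟩, -⟩) | ⟨⟨rfl, rfl⟩ | ⟨rfl, rfl⟩, -⟩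
    · rcases p with x | x <;> rcases q with y | y
      · refine ⟨(deleteEdges_adj.1 h.1).1, fun hmem => ?_⟩
        rcases Finset.mem_insert.1 (Finset.mem_coe.1 hmem) with h' | h'
        · exact (deleteEdges_adj.1 h.1).2 h'
        · exact h.2 h'
      · exact ⟨Finset.mem_insert_of_mem h.1, edgeSet_subset_edgeSet.2 (deleteEdges_le _) h.2.1,
          h.2.2⟩
      · exact ⟨Finset.mem_insert_of_mem h.1, edgeSet_subset_edgeSet.2 (deleteEdges_le _) h.2.1,
          h.2.2⟩
      · exact h.elim
    · exact hsub a (by simp)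
    · exact (hsub a (by simp)).symm
    · exact (hsub b (by simp)).symm
    · exact hsub b (by simp)

end Subdivide

section Seed

variable {X : Type*} {R : SimpleGraph X} {u v w : X} {g c : ℕ}

/-- Replacing `u' → w → v'` by an arc `u' → v'` would give an sc-orientation of `R` with the edge
`uv`: walks in the new digraph lift back with the same avoided vertex. -/
theorem IsSeed.not_adj_through (h : R.IsSeed u v w g c) {D : Digraph X}
    (hD : D.Orients (R ⊔ edge u w ⊔ edge w v)) (hs : D.SinglyConnected) {u' v' : X}
    (huv : s(u', v') = s(u, v)) : ¬ (D.Adj u' w ∧ D.Adj w v') := by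
  rintro ⟨h1, h2⟩
  apply h.not_scOrientable
  have huv' : u' ≠ v' := by
    rintro rfl
    rcases Sym2.eq_iff.1 huv with ⟨rfl, e⟩ | ⟨rfl, e⟩
    · exact h.ne_uv e
    · exact h.ne_uv e.symm
  have hu' : u' ≠ w := by rintro rfl; exact hD.irrefl _ h1
  have hv' : v' ≠ w := by rintro rfl; exact hD.irrefl _ h2
  have hedge : edge u v = edge u' v' := by
    rcases Sym2.eq_iff.1 huv with ⟨rfl, rfl⟩ | ⟨rfl, rfl⟩
    · rfl
    · exact edge_comm _ _
  have hnadj : ¬ R.Adj u' v' := by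
    rcases Sym2.eq_iff.1 huv with ⟨rfl, rfl⟩ | ⟨rfl, rfl⟩
    · exact h.not_adj
    · exact fun h' => h.not_adj h'.symm
  have hne : ∀ {x y}, R.Adj x y → x ≠ w := by
    rintro x y hxy rfl
    exact h.isolated _ hxy
  let D' : Digraph X := ⟨fun x y => (R.Adj x y ∧ D.Adj x y) ∨ (x = u' ∧ y = v')⟩
  have hD' : D'.Orients (R ⊔ edge u v) := by
    rw [hedge]
    refine ⟨?_, ?_, ?_⟩
    · rintro x y (h | ⟨rfl, rfl⟩)
      · exact .inl h.1
      · exact .inr (by simp [edge_adj, huv'])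
    · rintro x y (h | h)
      · exact (hD.total (show (R ⊔ edge u w ⊔ edge w v).Adj x y from .inl (.inl h))).imp
          (fun h' => .inl ⟨h, h'⟩) fun h' => .inl ⟨h.symm, h'⟩
      · rw [edge_adj] at h
        exact h.1.imp .inr fun h' => .inr h'.symm
    · rintro x y (h | ⟨rfl, rfl⟩) (h' | ⟨rfl, h'⟩)
      · exact hD.asymm h.2 h'.2
      · exact hnadj (h' ▸ h.1.symm)
      · exact hnadj h'.1.symm
      · exact huv' h'
  have hreach : ∀ s, s ≠ w → ∀ x t, D'.ReachAvoiding s x t → D.ReachAvoiding s x t := by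
    intro s hsw x t hxt
    induction hxt with
    | refl => exact .refl
    | tail _ hbc ih =>
      rcases hbc with ⟨hbc | ⟨rfl, rfl⟩, hne⟩
      · exact ih.tail ⟨hbc.2, hne⟩
      · exact (ih.tail ⟨h1, hsw.symm⟩).tail ⟨h2, hne⟩
  refine scOrientable_iff.2 ⟨D', hD', (Digraph.singlyConnected_iff hD'.irrefl).2 ?_⟩
  rw [Digraph.singlyConnected_iff hD.irrefl] at hs
  intro s x y t hx hy hxt hyt
  have hs' : s ≠ w := by
    rcases hx with hx | ⟨rfl, -⟩
    · exact hne hx.1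
    · exact hu'
  have hxt' := hreach s hs' x t hxt
  have hyt' := hreach s hs' y t hyt
  rcases hx with hx | ⟨rfl, rfl⟩ <;> rcases hy with hy | ⟨e, rfl⟩
  · exact hs s x y t hx.2 hy.2 hxt' hyt'
  · subst e
    exact absurd (hs s x w t hx.2 h1 hxt' (.head ⟨h2, huv'.symm⟩ hyt')) (hne hx.1.symm)
  · exact absurd (hs s y w t hy.2 h1 hyt' (.head ⟨h2, huv'.symm⟩ hxt')) (hne hy.1.symm)
  · rfl

theorem IsSeed.adj_iff (h : R.IsSeed u v w g c) {D : Digraph X}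
    (hD : D.Orients (R ⊔ edge u w ⊔ edge w v)) (hs : D.SinglyConnected) :
    D.Adj u w ↔ D.Adj v w := by
  have h1 := h.not_adj_through hD hs (u' := u) (v' := v) rfl
  have h2 := h.not_adj_through hD hs (u' := v) (v' := u) Sym2.eq_swap
  have h3 := hD.not_adj_iff (show (R ⊔ edge u w ⊔ edge w v).Adj u w from
    .inl (.inr (by simp [edge_adj, h.ne_uw])))
  have h4 := hD.not_adj_iff (show (R ⊔ edge u w ⊔ edge w v).Adj v w from
    .inr (by simp [edge_adj, h.ne_vw]))
  tauto

/-- The graph `R` of a seed has an sc-orientation in which no vertex reaches both terminals. -/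
theorem IsSeed.exists_orientation (h : R.IsSeed u v w g c) : ∃ D : Digraph X, D.Orients R ∧
    D.SinglyConnected ∧ ∀ s, D.Reach s u → ¬ D.Reach s v := by
  obtain ⟨D₀, o₀, s₀⟩ := scOrientable_iff.1 h.scOrientable
  have huw : (R ⊔ edge u w ⊔ edge w v).Adj u w := .inl (.inr (by simp [edge_adj, h.ne_uw]))
  -- After reversing all arcs if necessary, `w` is a sink. A vertex reaching both `u` and `v` would
  -- then have two paths to `w`.
  obtain ⟨D, o, s, hu⟩ : ∃ D : Digraph X, D.Orients (R ⊔ edge u w ⊔ edge w v) ∧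
      D.SinglyConnected ∧ D.Adj u w := by
    rcases o₀.total huw with h' | h'
    · exact ⟨D₀, o₀, s₀, h'⟩
    · exact ⟨D₀.rev, o₀.rev, s₀.rev, h'⟩
  have hv := (h.adj_iff o s).1 hu
  have hsink : ∀ x, ¬ D.Adj w x := by
    intro x hx
    rcases o.adj hx with (h' | h') | h'
    · exact h.isolated _ h'
    · rw [edge_adj] at h'
      rcases h'.1 with ⟨e, rfl⟩ | ⟨-, rfl⟩
      · exact h'.2 rfl
      · exact o.asymm hu hx
    · rw [edge_adj] at h'
      rcases h'.1 with ⟨-, rfl⟩ | ⟨e, rfl⟩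
      · exact o.asymm hv hx
      · exact h'.2 rfl
  refine ⟨D.pull R id, o.pull fun x y hxy => .inl (.inl hxy),
    s.of_injective Function.injective_id fun _ _ h => h.2, fun z hzu hzv => ?_⟩
  have hmono : ∀ t, (D.pull R id).Reach z t → D.Reach z t := fun t ht =>
    Relation.ReflTransGen.mono (p := D.Adj) (fun _ _ h => h.2) _ _ ht
  exact h.ne_uv (s.eq_of_reach_of_sink hsink hu hv (hmono _ hzu) (hmono _ hzv))

end Seed

end SimpleGraph

/-! ### Two copies of a seed glued at a terminal -/

namespace SimpleGraph

variable {X : Type*} (u v : X)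

open Classical in
/-- Two copies of `X` glued by identifying `v` of the first with `u` of the second. -/
noncomputable def gluedMap (b : Bool) (x : X) : X × Bool :=
  if b = true ∧ x = u then (v, false) else (x, b)

/-- The vertex of a copy that lies in both copies. -/
def joint : Bool → X
  | false => v
  | true => u

/-- The terminal of a copy that lies in no other copy. -/
def outer : Bool → X
  | false => u
  | true => v

/-- The three terminals of two glued copies. -/
def terminal : Fin 3 → X × Bool
  | 0 => (u, false)
  | 1 => (v, false)
  | 2 => (v, true)

/-- Two copies of the graph `R` glued by identifying `v` of the first with `u` of the second. -/
noncomputable def glued (R : SimpleGraph X) : SimpleGraph (X × Bool) :=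
  ⨆ b, R.map (gluedMap u v b)

/-- Two copies of the digraph `D` glued by identifying `v` of the first with `u` of the second. -/
def _root_.Digraph.glued (D : Digraph X) : Digraph (X × Bool) where
  Adj p q := ∃ b x y, D.Adj x y ∧ gluedMap u v b x = p ∧ gluedMap u v b y = q

variable {u v}

theorem gluedMap_false (x : X) : gluedMap u v false x = (x, false) := by simp [gluedMap]

theorem gluedMap_true_of_ne {x : X} (h : x ≠ u) : gluedMap u v true x = (x, true) := by
  simp [gluedMap, h]

theorem gluedMap_true_left : gluedMap u v true u = (v, false) := by simp [gluedMap]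

theorem gluedMap_injective (b : Bool) : Function.Injective (gluedMap u v b) := by
  intro x y h
  unfold gluedMap at h
  split_ifs at h <;> simp_all

theorem gluedMap_eq_not_iff {b : Bool} {x y : X} :
    gluedMap u v b x = gluedMap u v (!b) y ↔ x = joint u v b ∧ y = joint u v (!b) := by
  classical
  cases b
  · rw [gluedMap_false]
    by_cases h : y = u
    · subst h; simp [gluedMap_true_left, joint]
    · simp [gluedMap_true_of_ne h, joint, h]
  · rw [Bool.not_true, gluedMap_false]
    by_cases h : x = u
    · subst h; simp [gluedMap_true_left, joint, eq_comm]
    · simp [gluedMap_true_of_ne h, joint, h]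

theorem terminal_zero : terminal u v 0 = gluedMap u v false u := (gluedMap_false _).symm

theorem terminal_one : terminal u v 1 = gluedMap u v false v := (gluedMap_false _).symm

theorem terminal_one' : terminal u v 1 = gluedMap u v true u := gluedMap_true_left.symm

theorem terminal_two (h : u ≠ v) : terminal u v 2 = gluedMap u v true v :=
  (gluedMap_true_of_ne h.symm).symm

theorem glued_adj_iff {R : SimpleGraph X} {p q : X × Bool} : (R.glued u v).Adj p q ↔
    ∃ b x y, R.Adj x y ∧ gluedMap u v b x = p ∧ gluedMap u v b y = q := by
  simp only [glued, iSup_adj, map_adj']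
  constructor
  · rintro ⟨i, -, x, y, h⟩
    exact ⟨i, x, y, h⟩
  · rintro ⟨i, x, y, h, rfl, rfl⟩
    exact ⟨i, (gluedMap_injective i).ne h.ne, x, y, h, rfl, rfl⟩

section Digraph

variable {D : Digraph X} {R : SimpleGraph X}

theorem _root_.Digraph.Orients.glued (h : D.Orients R) : (D.glued u v).Orients (R.glued u v) := by
  refine ⟨?_, ?_, ?_⟩
  · rintro p q ⟨b, x, y, hxy, hp, hq⟩
    exact glued_adj_iff.2 ⟨b, x, y, h.adj hxy, hp, hq⟩
  · intro p q hpq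
    obtain ⟨b, x, y, hxy, hp, hq⟩ := glued_adj_iff.1 hpq
    exact (h.total hxy).imp (fun h' => ⟨b, x, y, h', hp, hq⟩) fun h' => ⟨b, y, x, h', hq, hp⟩
  · rintro p q ⟨b, x, y, hxy, rfl, rfl⟩ ⟨b', y', x', hxy', hy, hx⟩
    by_cases hb : b' = b
    · subst hb
      rw [gluedMap_injective _ hx, gluedMap_injective _ hy] at hxy'
      exact h.asymm hxy hxy'
    · obtain rfl : b' = !b := by cases b <;> cases b' <;> simp_all
      rw [eq_comm, gluedMap_eq_not_iff] at hx hy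
      rw [hx.1, hy.1] at hxy
      exact h.irrefl _ hxy

/-- The copies share a single vertex, so a walk changes copies only at the joint, and an excursion
returns to where it left. -/
theorem reach_glued {b : Bool} {x : X} {t : X × Bool}
    (h : (D.glued u v).Reach (gluedMap u v b x) t) :
    (∃ t', t = gluedMap u v b t' ∧ D.Reach x t') ∨ (D.Reach x (joint u v b) ∧
      ∃ t', t = gluedMap u v (!b) t' ∧ D.Reach (joint u v (!b)) t') := by
  induction h with
  | refl => exact .inl ⟨x, rfl, .refl⟩
  | @tail p q _ hpq ih =>
    obtain ⟨b', y, z, hyz, hp, rfl⟩ := hpq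
    by_cases hb : b' = b
    · subst hb
      left
      refine ⟨z, rfl, ?_⟩
      rcases ih with ⟨t', rfl, h⟩ | ⟨h, t', rfl, -⟩
      · rw [gluedMap_injective _ hp] at hyz
        exact h.tail hyz
      · rw [(gluedMap_eq_not_iff.1 hp).1] at hyz
        exact h.tail hyz
    · obtain rfl : b' = !b := by cases b <;> cases b' <;> simp_all
      right
      rcases ih with ⟨t', rfl, h⟩ | ⟨h, t', rfl, h'⟩
      · rw [eq_comm, gluedMap_eq_not_iff] at hp
        rw [hp.1] at h
        rw [hp.2] at hyz
        exact ⟨h, z, rfl, .single hyz⟩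
      · rw [gluedMap_injective _ hp] at hyz
        exact ⟨h, z, rfl, h'.tail hyz⟩

theorem reachAvoiding_glued {b : Bool} {s x : X} {t : X × Bool}
    (h : (D.glued u v).ReachAvoiding (gluedMap u v b s) (gluedMap u v b x) t) :
    (∃ t', t = gluedMap u v b t' ∧ D.ReachAvoiding s x t') ∨
      (D.ReachAvoiding s x (joint u v b) ∧ ∃ t', t = gluedMap u v (!b) t') := by
  induction h with
  | refl => exact .inl ⟨x, rfl, .refl⟩
  | @tail p q _ hpq ih =>
    obtain ⟨⟨b', y, z, hyz, hp, rfl⟩, hne⟩ := hpq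
    by_cases hb : b' = b
    · subst hb
      left
      have hz : z ≠ s := fun e => hne (e ▸ rfl)
      refine ⟨z, rfl, ?_⟩
      rcases ih with ⟨t', rfl, h⟩ | ⟨h, t', rfl⟩
      · rw [gluedMap_injective _ hp] at hyz
        exact h.tail ⟨hyz, hz⟩
      · rw [(gluedMap_eq_not_iff.1 hp).1] at hyz
        exact h.tail ⟨hyz, hz⟩
    · obtain rfl : b' = !b := by cases b <;> cases b' <;> simp_all
      right
      rcases ih with ⟨t', rfl, h⟩ | ⟨h, t', rfl⟩
      · rw [eq_comm, gluedMap_eq_not_iff] at hp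
        rw [hp.1] at h
        exact ⟨h, z, rfl⟩
      · exact ⟨h, z, rfl⟩

/-- Two out-arcs in one copy are compared inside it, with the joint replacing an endpoint in the
other copy. Out-arcs in different copies start at the joint, and walks avoiding it cannot meet. -/
theorem singlyConnected_glued (o : D.Orients R) (h : D.SinglyConnected) :
    (D.glued u v).SinglyConnected := by
  rw [Digraph.singlyConnected_iff o.irrefl] at h
  rw [Digraph.singlyConnected_iff o.glued.irrefl]
  rintro s x y t ⟨b, s₁, x₁, hx, rfl, rfl⟩ ⟨b', s₂, y₁, hy, hs, rfl⟩ hxt hyt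
  by_cases hb : b' = b
  · subst hb
    rw [gluedMap_injective _ hs] at hy
    congr 1
    rcases reachAvoiding_glued hxt with ⟨t', rfl, hx'⟩ | ⟨hx', t', rfl⟩ <;>
      rcases reachAvoiding_glued hyt with ⟨t'', e, hy'⟩ | ⟨hy', t'', e⟩
    · rw [gluedMap_injective _ e] at hx'
      exact h _ _ _ _ hx hy hx' hy'
    · rw [(gluedMap_eq_not_iff.1 e).1] at hx'
      exact h _ _ _ _ hx hy hx' hy'
    · rw [(gluedMap_eq_not_iff.1 e.symm).1] at hy'
      exact h _ _ _ _ hx hy hx' hy'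
    · exact h _ _ _ _ hx hy hx' hy'
  · exfalso
    obtain rfl : b' = !b := by cases b <;> cases b' <;> simp_all
    have hs' := gluedMap_eq_not_iff.1 hs.symm
    have key : ∀ (b : Bool) (z : X) (t : X × Bool), D.Adj (joint u v b) z →
        (D.glued u v).ReachAvoiding (gluedMap u v b (joint u v b)) (gluedMap u v b z) t →
        ∃ t', t = gluedMap u v b t' ∧ t' ≠ joint u v b := by
      intro b z t hz hzt
      have hz' : z ≠ joint u v b := by rintro e; rw [e] at hz; exact o.irrefl _ hz
      rcases reachAvoiding_glued hzt with ⟨t', rfl, ht⟩ | ⟨ht, -⟩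
      · exact ⟨t', rfl, ht.ne hz'⟩
      · exact absurd rfl (ht.ne hz')
    rw [← hs] at hyt
    rw [hs'.1] at hx hxt
    rw [hs'.2] at hy
    have hyt' : (D.glued u v).ReachAvoiding (gluedMap u v (!b) (joint u v (!b)))
        (gluedMap u v (!b) y₁) t := by
      rw [hs, hs'.1] at hyt
      rwa [← gluedMap_eq_not_iff.2 ⟨rfl, rfl⟩]
    obtain ⟨t', rfl, h1⟩ := key _ _ _ hx hxt
    obtain ⟨t'', e, -⟩ := key _ _ _ hy hyt'
    exact h1 (gluedMap_eq_not_iff.1 e).1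

/-- Within a copy at most one terminal is reachable, and the far terminal of the other copy would
have to be reached from the joint, which is itself a terminal there. -/
theorem terminal_eq_of_reach (huv : u ≠ v) (hD : ∀ s, D.Reach s u → ¬ D.Reach s v)
    {s : X × Bool} {i j : Fin 3} (hi : (D.glued u v).Reach s (terminal u v i))
    (hj : (D.glued u v).Reach s (terminal u v j)) : i = j := by
  have hrange : ∃ b x, s = gluedMap u v b x := by
    rcases Relation.ReflTransGen.cases_head hi with h | ⟨r, ⟨b, x, -, -, h, -⟩, -⟩
    · subst h
      fin_cases i
      · exact ⟨_, _, terminal_zero⟩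
      · exact ⟨_, _, terminal_one⟩
      · exact ⟨_, _, terminal_two huv⟩
    · exact ⟨b, x, h.symm⟩
  obtain ⟨b, x, rfl⟩ := hrange
  have hD' : ∀ (b : Bool) s, D.Reach s (joint u v b) → ¬ D.Reach s (outer u v b) := by
    intro b s h1 h2
    cases b
    · exact hD s h2 h1
    · exact hD s h1 h2
  have hne : ∀ b, outer u v b ≠ joint u v b := by
    intro b
    cases b
    · exact huv
    · exact huv.symm
  have k1 : (D.glued u v).Reach (gluedMap u v b x) (gluedMap u v b (outer u v b)) →
      D.Reach x (outer u v b) := by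
    intro h
    rcases reach_glued h with ⟨t', e, h'⟩ | ⟨-, t', e, -⟩
    · rwa [gluedMap_injective _ e]
    · exact absurd (gluedMap_eq_not_iff.1 e).1 (hne b)
  have k2 : (D.glued u v).Reach (gluedMap u v b x) (gluedMap u v b (joint u v b)) →
      D.Reach x (joint u v b) := by
    intro h
    rcases reach_glued h with ⟨t', e, h'⟩ | ⟨h', -⟩
    · rwa [gluedMap_injective _ e]
    · exact h'
  have k3 : ¬ (D.glued u v).Reach (gluedMap u v b x) (gluedMap u v (!b) (outer u v (!b))) := by
    intro h
    rcases reach_glued h with ⟨t', e, h'⟩ | ⟨-, t', e, h'⟩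
    · exact hne _ (gluedMap_eq_not_iff.1 e.symm).2
    · rw [← gluedMap_injective _ e] at h'
      exact hD' _ _ .refl h'
  have k4 := hD' b x
  cases b
  · have e0 : terminal u v 0 = gluedMap u v false (outer u v false) := terminal_zero
    have e1 : terminal u v 1 = gluedMap u v false (joint u v false) := terminal_one
    have e2 : terminal u v 2 = gluedMap u v (!false) (outer u v (!false)) := terminal_two huv
    rw [← e0] at k1
    rw [← e1] at k2
    rw [← e2] at k3
    fin_cases i <;> fin_cases j <;> first
      | rfl
      | exact absurd hi k3
      | exact absurd hj k3
      | exact absurd (k1 hi) (k4 (k2 hj))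
      | exact absurd (k1 hj) (k4 (k2 hi))
  · have e0 : terminal u v 2 = gluedMap u v true (outer u v true) := terminal_two huv
    have e1 : terminal u v 1 = gluedMap u v true (joint u v true) := terminal_one'
    have e2 : terminal u v 0 = gluedMap u v (!true) (outer u v (!true)) := terminal_zero
    rw [← e0] at k1
    rw [← e1] at k2
    rw [← e2] at k3
    fin_cases i <;> fin_cases j <;> first
      | rfl
      | exact absurd hi k3
      | exact absurd hj k3
      | exact absurd (k1 hi) (k4 (k2 hj))
      | exact absurd (k1 hj) (k4 (k2 hi))

end Digraph

section Seed

variable {R : SimpleGraph X} {w : X} {g c : ℕ}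

theorem glued_apply {α : Type*} {f₀ f₁ : X → α} (h : f₀ v = f₁ u) (b : Bool) (x : X) :
    (if (gluedMap u v b x).2 then f₁ (gluedMap u v b x).1 else f₀ (gluedMap u v b x).1) =
      if b then f₁ x else f₀ x := by
  cases b
  · simp [gluedMap_false]
  · by_cases hx : x = u
    · subst hx; simp [gluedMap_true_left, h]
    · simp [gluedMap_true_of_ne hx]

theorem IsSeed.exists_coloring (h : R.IsSeed u v w g c) {α β γ : Fin c} (hαβ : α ≠ β)
    (hβγ : β ≠ γ) : ∃ f : (R.glued u v).Coloring (Fin c),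
      f (terminal u v 0) = α ∧ f (terminal u v 1) = β ∧ f (terminal u v 2) = γ := by
  obtain ⟨C⟩ := h.colorable
  have huv : C u ≠ C v := C.valid (.inr (by simp [edge_adj, h.ne_uv]))
  obtain ⟨f₀, h1, h2, -⟩ := C.exists_recolor huv hαβ
  obtain ⟨f₁, h3, h4, -⟩ := C.exists_recolor huv hβγ
  have key := glued_apply (u := u) (v := v) (f₀ := f₀) (f₁ := f₁) (h2.trans h3.symm)
  refine ⟨Coloring.mk (fun p : X × Bool => if p.2 then f₁ p.1 else f₀ p.1) ?_, h1, h2, h4⟩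
  intro p q hpq
  obtain ⟨b, x, y, hxy, rfl, rfl⟩ := glued_adj_iff.1 hpq
  simp only [key]
  cases b
  · exact f₀.valid (.inl hxy)
  · exact f₁.valid (.inl hxy)

theorem LipschitzOff.glued {e : Sym2 (X × Bool)} {h₀ h₁ : X → ℤ} (h : h₀ v = h₁ u)
    (l₀ : ∀ x y, R.Adj x y → s(gluedMap u v false x, gluedMap u v false y) ≠ e →
      |h₀ x - h₀ y| ≤ 1)
    (l₁ : ∀ x y, R.Adj x y → s(gluedMap u v true x, gluedMap u v true y) ≠ e →
      |h₁ x - h₁ y| ≤ 1) :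
    (R.glued u v).LipschitzOff e fun p : X × Bool => if p.2 then h₁ p.1 else h₀ p.1 := by
  have key := glued_apply (u := u) (v := v) h
  intro p q hpq hne
  obtain ⟨b, x, y, hxy, rfl, rfl⟩ := glued_adj_iff.1 hpq
  simp only [key]
  cases b
  · exact l₀ x y hxy hne
  · exact l₁ x y hxy hne

/-- Since `R` with the edge `uv` has girth at least `g`, the terminals are far apart in `R` alone.
-/
theorem IsSeed.exists_separating_potential (h : R.IsSeed u v w g c) (hg : 1 ≤ g) :
    ∃ k : X → ℤ, (∀ x y, R.Adj x y → |k x - k y| ≤ 1) ∧ k u = 0 ∧ k v = g - 1 := by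
  obtain ⟨k, hl, hu, hv, -⟩ := exists_potential hg h.le_egirth
    (show (R ⊔ edge u v).Adj u v from .inr (by simp [edge_adj, h.ne_uv]))
  refine ⟨k, fun x y hxy => hl x y (.inl hxy) fun e => ?_, hu, hv⟩
  rcases Sym2.eq_iff.1 e with ⟨rfl, rfl⟩ | ⟨rfl, rfl⟩
  · exact h.not_adj hxy
  · exact h.not_adj hxy.symm

/-- Two glued copies carry potentials taking the values `0` and `g - 1` on the terminals in
nondecreasing order. -/
theorem IsSeed.exists_glued_potential (h : R.IsSeed u v w g c) (hg : 1 ≤ g) {α β γ : ℤ}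
    (hαβ : α = β ∨ (α = 0 ∧ β = g - 1)) (hβγ : β = γ ∨ (β = 0 ∧ γ = g - 1)) :
    ∃ k : X × Bool → ℤ, (∀ p q, (R.glued u v).Adj p q → |k p - k q| ≤ 1) ∧
      k (terminal u v 0) = α ∧ k (terminal u v 1) = β ∧ k (terminal u v 2) = γ := by
  have key : ∀ α β : ℤ, (α = β ∨ (α = 0 ∧ β = g - 1)) → ∃ k : X → ℤ,
      (∀ x y, R.Adj x y → |k x - k y| ≤ 1) ∧ k u = α ∧ k v = β := by
    rintro α β (rfl | ⟨rfl, rfl⟩)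
    · exact ⟨fun _ => α, by simp⟩
    · exact h.exists_separating_potential hg
  obtain ⟨k₀, l₀, u₀, v₀⟩ := key α β hαβ
  obtain ⟨k₁, l₁, u₁, v₁⟩ := key β γ hβγ
  refine ⟨fun p => if p.2 then k₁ p.1 else k₀ p.1, ?_, u₀, v₀, v₁⟩
  have hk := glued_apply (u := u) (v := v) (v₀.trans u₁.symm)
  intro p q hpq
  obtain ⟨b, x, y, hxy, rfl, rfl⟩ := glued_adj_iff.1 hpq
  simp only [hk]
  cases b
  · exact l₀ x y hxy
  · exact l₁ x y hxy

/-- A potential for an edge of two glued copies that is nearly constant on the terminals. -/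
theorem IsSeed.exists_glued_edge_potential (h : R.IsSeed u v w g c) (hg : 1 ≤ g) {p q : X × Bool}
    (hpq : (R.glued u v).Adj p q) : ∃ (k : X × Bool → ℤ) (κ : ℤ),
      (R.glued u v).LipschitzOff s(p, q) k ∧ (g : ℤ) - 1 ≤ |k p - k q| ∧
      ∀ i, |k (terminal u v i) - κ| ≤ 1 := by
  obtain ⟨b, x, y, hxy, rfl, rfl⟩ := glued_adj_iff.1 hpq
  obtain ⟨k, hl, hx, hy, -⟩ := exists_potential hg h.le_egirth
    (show (R ⊔ edge u v).Adj x y from .inl hxy)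
  -- Because `uv` is an edge of the enlarged graph, the potential varies by at most 1 between
  -- terminals; outside the copy containing the edge it can be constant.
  have huv : |k u - k v| ≤ 1 := by
    refine hl u v (.inr (by simp [edge_adj, h.ne_uv])) fun e => ?_
    rcases Sym2.eq_iff.1 e with ⟨rfl, rfl⟩ | ⟨rfl, rfl⟩
    · exact h.not_adj hxy
    · exact h.not_adj hxy.symm
  have hlip : ∀ x' y', R.Adj x' y' →
      s(gluedMap u v b x', gluedMap u v b y') ≠ s(gluedMap u v b x, gluedMap u v b y) →
      |k x' - k y'| ≤ 1 := by
    intro x' y' hxy' hne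
    refine hl x' y' (.inl hxy') fun e => hne ?_
    rcases Sym2.eq_iff.1 e with ⟨rfl, rfl⟩ | ⟨rfl, rfl⟩
    · rfl
    · exact Sym2.eq_swap
  have hfar : (g : ℤ) - 1 ≤ |k x - k y| := by
    rw [hx, hy, abs_sub_comm]; simp [le_abs_self]
  cases b
  · refine ⟨fun p => if p.2 then k v else k p.1, k v,
      LipschitzOff.glued (h₀ := k) (h₁ := fun _ => k v) rfl hlip (by simp), ?_, ?_⟩
    · simpa [gluedMap_false] using hfar
    · intro i
      fin_cases i
      · exact huv
      · simp [terminal]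
      · simp [terminal]
  · have hk := glued_apply (u := u) (v := v) (f₀ := fun _ => k u) (f₁ := k) rfl
    refine ⟨fun p => if p.2 then k p.1 else k u, k u,
      LipschitzOff.glued (h₀ := fun _ => k u) (h₁ := k) rfl (by simp) hlip, ?_, ?_⟩
    · simp only [hk]
      exact hfar
    · intro i
      fin_cases i
      · simp [terminal]
      · simp [terminal]
      · rw [abs_sub_comm]; exact huv

end Seed

end SimpleGraph

/-! ### The coupling gadget: two glued pairs joined by a zigzag path -/

namespace SimpleGraph

section CrossSum

variable {V W : Type*}

/-- The disjoint union of two graphs together with edges `E` between them. -/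
def crossSum (G : SimpleGraph V) (H : SimpleGraph W) (E : V → W → Prop) :
    SimpleGraph (V ⊕ W) where
  Adj
    | .inl x, .inl y => G.Adj x y
    | .inl x, .inr y => E x y
    | .inr y, .inl x => E x y
    | .inr x, .inr y => H.Adj x y
  symm := ⟨by
    rintro (x | x) (y | y) h
    · exact Adj.symm h
    · exact h
    · exact h
    · exact Adj.symm h⟩
  loopless := ⟨by
    rintro (x | x) h
    · exact G.irrefl h
    · exact H.irrefl h⟩

theorem _root_.Digraph.Orients.crossSum {G : SimpleGraph V} {H : SimpleGraph W} {D₁ : Digraph V}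
    {D₂ : Digraph W} {E : V → W → Prop} (h₁ : D₁.Orients G) (h₂ : D₂.Orients H) :
    (D₁.crossSum D₂ E).Orients (G.crossSum H E) := by
  refine ⟨?_, ?_, ?_⟩
  · rintro (x | x) (y | y) h
    · exact h₁.adj h
    · exact h
    · exact h.elim
    · exact h₂.adj h
  · rintro (x | x) (y | y) h
    · exact h₁.total h
    · exact .inl h
    · exact .inr h
    · exact h₂.total h
  · rintro (x | x) (y | y) h h'
    · exact h₁.asymm h h'
    · exact h'
    · exact h
    · exact h₂.asymm h h'

theorem lipschitzOff_crossSum {G : SimpleGraph V} {H : SimpleGraph W} {E : V → W → Prop}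
    {e : Sym2 (V ⊕ W)} {h₁ : V → ℤ} {h₂ : W → ℤ}
    (l₁ : ∀ x y, G.Adj x y → s((.inl x : V ⊕ W), .inl y) ≠ e → |h₁ x - h₁ y| ≤ 1)
    (l₂ : ∀ x y, H.Adj x y → s((.inr x : V ⊕ W), .inr y) ≠ e → |h₂ x - h₂ y| ≤ 1)
    (l : ∀ x y, E x y → s((.inl x : V ⊕ W), .inr y) ≠ e → |h₁ x - h₂ y| ≤ 1) :
    (G.crossSum H E).LipschitzOff e (Sum.elim h₁ h₂) := by
  rintro (x | x) (y | y) h hne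
  · exact l₁ x y h hne
  · exact l x y h hne
  · rw [abs_sub_comm]
    exact l y x h (by rwa [Sym2.eq_swap])
  · exact l₂ x y h hne

end CrossSum

section Gadget

variable {X : Type*} (u v : X)

/-- The edges of the path that runs alternately through the terminals of two copies. -/
def Zigzag (p q : X × Bool) : Prop :=
  ∃ i j : Fin 3, (j = i ∨ (j : ℕ) + 1 = i) ∧ p = terminal u v i ∧ q = terminal u v j

/-- Two copies of two glued copies of `R`, joined by a zigzag path through their terminals. -/
noncomputable def gadget (R : SimpleGraph X) : SimpleGraph ((X × Bool) ⊕ (X × Bool)) :=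
  (R.glued u v).crossSum (R.glued u v) (Zigzag u v)

variable {u v} {R : SimpleGraph X} {w : X} {g c : ℕ}

theorem _root_.Digraph.reach_rev {V : Type*} {D : Digraph V} {x y : V} :
    D.rev.Reach x y ↔ D.Reach y x :=
  Relation.reflTransGen_swap

/-- The left side is oriented by a seed orientation, the right side by its reverse, and the zigzag
from left to right. No vertex on the left reaches two terminals and none on the right is reached
from two, so paths cross uniquely and never lead from index 0 to index 2. -/
theorem IsSeed.gadget_orientation (h : R.IsSeed u v w g c) :
    ∃ D : Digraph ((X × Bool) ⊕ (X × Bool)), D.Orients (R.gadget u v) ∧ D.SinglyConnected ∧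
      ∀ x ∈ ({.inl (terminal u v 0), .inr (terminal u v 0)} : Set ((X × Bool) ⊕ (X × Bool))),
      ∀ y ∈ ({.inl (terminal u v 2), .inr (terminal u v 2)} : Set ((X × Bool) ⊕ (X × Bool))),
        ¬ D.Reach x y := by
  obtain ⟨D, o, s, hD⟩ := h.exists_orientation
  have hT : ∀ {s : X × Bool} {i j : Fin 3}, (D.glued u v).Reach s (terminal u v i) →
      (D.glued u v).Reach s (terminal u v j) → i = j := terminal_eq_of_reach h.ne_uv hD
  have sA := singlyConnected_glued (u := u) (v := v) o s
  refine ⟨(D.glued u v).crossSum (D.glued u v).rev (Zigzag u v), o.glued.crossSum o.glued.rev,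
    Digraph.singlyConnected_crossSum o.glued.irrefl o.glued.rev.irrefl sA sA.rev ?_ ?_, ?_⟩
  · rintro s p p' q q' ⟨i, -, -, rfl, -⟩ ⟨i', -, -, rfl, -⟩ h1 h2
    rw [hT h1 h2]
  · rintro t p p' q q' ⟨-, j, -, -, rfl⟩ ⟨-, j', -, -, rfl⟩ h1 h2
    rw [hT (Digraph.reach_rev.1 h1) (Digraph.reach_rev.1 h2)]
  · have h02 : ¬ (D.glued u v).Reach (terminal u v 0) (terminal u v 2) := fun h' => by
      simpa using hT .refl h'
    have h20 : ¬ (D.glued u v).Reach (terminal u v 2) (terminal u v 0) := fun h' => by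
      simpa using hT .refl h'
    rintro x (rfl | rfl) y (rfl | rfl) hxy
    · rcases Digraph.reach_crossSum_inl hxy with ⟨t, e, h'⟩ | ⟨t, e, -⟩
      · cases e
        exact h02 h'
      · cases e
    · rcases Digraph.reach_crossSum_inl hxy with ⟨t, e, -⟩ | ⟨t, e, p, q, hpq, h1, h2⟩
      · cases e
      · cases e
        obtain ⟨i, j, hij, rfl, rfl⟩ := hpq
        have hi : 0 = i := hT .refl h1
        subst hi
        have hj : j = 0 := by
          rcases hij with hij | hij
          · exact hij
          · simp at hij
        subst hj
        exact h20 (Digraph.reach_rev.1 h2)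
    · obtain ⟨t, e, -⟩ := Digraph.reach_crossSum_inr hxy
      cases e
    · obtain ⟨t, e, h'⟩ := Digraph.reach_crossSum_inr hxy
      cases e
      exact h20 (Digraph.reach_rev.1 h')

/-- Wherever a copy of `R` has its terminals joined to an outside vertex `z`, that vertex plays the
role of `w`. -/
theorem IsSeed.adj_iff_of_embedding (h : R.IsSeed u v w g c) {Y : Type*} {H : SimpleGraph Y}
    {D : Digraph Y} (hD : D.Orients H) (hs : D.SinglyConnected) {φ : X → Y} {z : Y}
    (hφ : Function.Injective φ) (hz : ∀ x, φ x ≠ z) (hR : ∀ x y, R.Adj x y → H.Adj (φ x) (φ y))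
    (hu : H.Adj (φ u) z) (hv : H.Adj (φ v) z) : D.Adj (φ u) z ↔ D.Adj (φ v) z := by
  classical
  let ψ : X → Y := fun x => if x = w then z else φ x
  have hψ : Function.Injective ψ := by
    intro x y hxy
    simp only [ψ] at hxy
    split_ifs at hxy with h1 h2 h2
    · rw [h1, h2]
    · exact absurd hxy.symm (hz y)
    · exact absurd hxy (hz x)
    · exact hφ hxy
  have hψu : ψ u = φ u := by simp [ψ, h.ne_uw]
  have hψv : ψ v = φ v := by simp [ψ, h.ne_vw]
  have hψw : ψ w = z := by simp [ψ]
  have hne : ∀ {x y}, R.Adj x y → x ≠ w := by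
    rintro x y hxy rfl
    exact h.isolated _ hxy
  have hhom : ∀ x y, (R ⊔ edge u w ⊔ edge w v).Adj x y → H.Adj (ψ x) (ψ y) := by
    intro x y hxy
    rw [sup_adj, sup_adj, edge_adj, edge_adj] at hxy
    rcases hxy with (hxy | ⟨⟨rfl, rfl⟩ | ⟨rfl, rfl⟩, -⟩) | ⟨⟨rfl, rfl⟩ | ⟨rfl, rfl⟩, -⟩
    · simpa [ψ, hne hxy, hne hxy.symm] using hR x y hxy
    · rwa [hψu, hψw]
    · rw [hψu, hψw]; exact hu.symm
    · rw [hψv, hψw]; exact hv.symm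
    · rwa [hψv, hψw]
  have := h.adj_iff (hD.pull hhom) (hs.of_injective hψ fun _ _ h' => h'.2)
  have huw : (R ⊔ edge u w ⊔ edge w v).Adj u w := .inl (.inr (by simp [edge_adj, h.ne_uw]))
  have hvw : (R ⊔ edge u w ⊔ edge w v).Adj v w := .inr (by simp [edge_adj, h.ne_vw])
  simpa only [Digraph.pull, huw, hvw, true_and, hψu, hψv, hψw] using this

theorem gadget_adj_zigzag {i j : Fin 3} (hij : j = i ∨ (j : ℕ) + 1 = i) :
    (R.gadget u v).Adj (.inl (terminal u v i)) (.inr (terminal u v j)) :=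
  ⟨i, j, hij, rfl, rfl⟩

theorem IsSeed.gadget_coupled (h : R.IsSeed u v w g c) {D : Digraph ((X × Bool) ⊕ (X × Bool))}
    (hD : D.Orients (R.gadget u v)) (hs : D.SinglyConnected) :
    D.Adj (.inl (terminal u v 0)) (.inr (terminal u v 0)) ↔
      D.Adj (.inl (terminal u v 2)) (.inr (terminal u v 2)) := by
  have hg : ∀ b x y, R.Adj x y → (R.glued u v).Adj (gluedMap u v b x) (gluedMap u v b y) :=
    fun b x y hxy => glued_adj_iff.2 ⟨b, x, y, hxy, rfl, rfl⟩
  have left : ∀ (b : Bool) (q : X × Bool), Zigzag u v (gluedMap u v b u) q →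
      Zigzag u v (gluedMap u v b v) q →
      (D.Adj (.inl (gluedMap u v b u)) (.inr q) ↔ D.Adj (.inl (gluedMap u v b v)) (.inr q)) :=
    fun b q h1 h2 => h.adj_iff_of_embedding hD hs (φ := fun x => .inl (gluedMap u v b x))
      (Sum.inl_injective.comp (gluedMap_injective b)) (by simp) (hg b) h1 h2
  have right : ∀ (b : Bool) (p : X × Bool), Zigzag u v p (gluedMap u v b u) →
      Zigzag u v p (gluedMap u v b v) →
      (D.Adj (.inr (gluedMap u v b u)) (.inl p) ↔ D.Adj (.inr (gluedMap u v b v)) (.inl p)) :=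
    fun b p h1 h2 => h.adj_iff_of_embedding hD hs (φ := fun x => .inr (gluedMap u v b x))
      (Sum.inr_injective.comp (gluedMap_injective b)) (by simp) (hg b) h1 h2
  have z : ∀ i j : Fin 3, (j = i ∨ (j : ℕ) + 1 = i) →
      Zigzag u v (terminal u v i) (terminal u v j) := fun i j hij => ⟨i, j, hij, rfl, rfl⟩
  have l0 := left false (terminal u v 0)
  have l1 := left true (terminal u v 1)
  have r0 := right false (terminal u v 1)
  have r1 := right true (terminal u v 2)
  rw [← terminal_zero, ← terminal_one] at l0 r0
  rw [← terminal_one', ← terminal_two h.ne_uv] at l1 r1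
  have l0 := l0 (z 0 0 (by simp)) (z 1 0 (by simp))
  have r0 := r0 (z 1 0 (by simp)) (z 1 1 (by simp))
  have l1 := l1 (z 1 1 (by simp)) (z 2 1 (by simp))
  have r1 := r1 (z 2 1 (by simp)) (z 2 2 (by simp))
  have n10 := hD.not_adj_iff (gadget_adj_zigzag (R := R) (u := u) (v := v) (i := 1) (j := 0)
    (by simp))
  have n11 := hD.not_adj_iff (gadget_adj_zigzag (R := R) (u := u) (v := v) (i := 1) (j := 1)
    (by simp))
  have n21 := hD.not_adj_iff (gadget_adj_zigzag (R := R) (u := u) (v := v) (i := 2) (j := 1)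
    (by simp))
  have n22 := hD.not_adj_iff (gadget_adj_zigzag (R := R) (u := u) (v := v) (i := 2) (j := 2)
    (by simp))
  -- The four inner vertices of the zigzag are each a source or a sink within it, so the
  -- left-to-right direction propagates from the first edge to the last.
  rw [l0, ← not_iff_not, n10, r0, ← n11, l1, n21, r1, ← n22]

theorem IsSeed.gadget_coloring (h : R.IsSeed u v w g c) {α β γ α' β' γ' : Fin c} (h1 : α ≠ β)
    (h2 : β ≠ γ) (h3 : α' ≠ β') (h4 : β' ≠ γ') (h5 : α ≠ α') (h6 : β ≠ α') (h7 : β ≠ β')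
    (h8 : γ ≠ β') (h9 : γ ≠ γ') : ∃ f : (R.gadget u v).Coloring (Fin c),
      f (.inl (terminal u v 0)) = α ∧ f (.inr (terminal u v 0)) = α' ∧
      f (.inl (terminal u v 2)) = γ ∧ f (.inr (terminal u v 2)) = γ' := by
  obtain ⟨f, rfl, rfl, rfl⟩ := h.exists_coloring h1 h2
  obtain ⟨f', rfl, rfl, rfl⟩ := h.exists_coloring h3 h4
  refine ⟨Coloring.mk (Sum.elim f f') ?_, rfl, rfl, rfl, rfl⟩
  have hz : ∀ p q, Zigzag u v p q → f p ≠ f' q := by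
    rintro p q ⟨i, j, hij, rfl, rfl⟩
    fin_cases i <;> fin_cases j <;> first | assumption | (exfalso; revert hij; simp)
  rintro (p | p) (q | q) hpq
  · exact f.valid hpq
  · exact hz p q hpq
  · exact (hz q p hpq).symm
  · exact f'.valid hpq

/-- Potentials for the edge of the zigzag path with ends `i` and `j`, from values on the terminals
that agree along all other edges of the path. -/
theorem IsSeed.exists_zigzag_potential (h : R.IsSeed u v w g c) (hg : 1 ≤ g) {i j : Fin 3}
    {α β γ α' β' γ' : ℤ} (h1 : α = β ∨ (α = 0 ∧ β = g - 1)) (h2 : β = γ ∨ (β = 0 ∧ γ = g - 1))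
    (h3 : α' = β' ∨ (α' = 0 ∧ β' = g - 1)) (h4 : β' = γ' ∨ (β' = 0 ∧ γ' = g - 1))
    (e₀₀ : (i = 0 ∧ j = 0) ∨ α = α') (e₁₀ : (i = 1 ∧ j = 0) ∨ β = α')
    (e₁₁ : (i = 1 ∧ j = 1) ∨ β = β') (e₂₁ : (i = 2 ∧ j = 1) ∨ γ = β')
    (e₂₂ : (i = 2 ∧ j = 2) ∨ γ = γ') (hfar : (g : ℤ) - 1 ≤ |![α, β, γ] i - ![α', β', γ'] j|) :
    ∃ k, (R.gadget u v).LipschitzOff s(.inl (terminal u v i), .inr (terminal u v j)) k ∧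
      (g : ℤ) - 1 ≤ |k (.inl (terminal u v i)) - k (.inr (terminal u v j))| := by
  obtain ⟨k₁, l₁, rfl, rfl, rfl⟩ := h.exists_glued_potential hg h1 h2
  obtain ⟨k₂, l₂, rfl, rfl, rfl⟩ := h.exists_glued_potential hg h3 h4
  refine ⟨Sum.elim k₁ k₂, lipschitzOff_crossSum (fun x y hxy _ => l₁ x y hxy)
    (fun x y hxy _ => l₂ x y hxy) ?_, ?_⟩
  · rintro p q ⟨i', j', hij', rfl, rfl⟩ hne
    have hne' : ¬ (i = i' ∧ j = j') := by rintro ⟨rfl, rfl⟩; exact hne rfl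
    have heq : k₁ (terminal u v i') = k₂ (terminal u v j') := by
      fin_cases i' <;> fin_cases j' <;> first
        | exact e₀₀.resolve_left hne'
        | exact e₁₀.resolve_left hne'
        | exact e₁₁.resolve_left hne'
        | exact e₂₁.resolve_left hne'
        | exact e₂₂.resolve_left hne'
        | (exfalso; revert hij'; simp)
    rw [heq]
    simp
  · simp only [Sum.elim_inl, Sum.elim_inr]
    fin_cases i <;> fin_cases j <;> exact hfar

theorem IsSeed.le_egirth_gadget (h : R.IsSeed u v w g c) (hg : 1 ≤ g) :
    (g : ℕ∞) ≤ (R.gadget u v).egirth := by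
  -- Deleting a zigzag edge cuts the path in two; the potential is `0` on the terminals of the first
  -- piece and `g - 1` on those of the second.
  have cross : ∀ i j : Fin 3, (j = i ∨ (j : ℕ) + 1 = i) → ∃ k,
      (R.gadget u v).LipschitzOff s(.inl (terminal u v i), .inr (terminal u v j)) k ∧
      (g : ℤ) - 1 ≤ |k (.inl (terminal u v i)) - k (.inr (terminal u v j))| := by
    intro i j hij
    have up : (0 : ℤ) = g - 1 ∨ ((0 : ℤ) = 0 ∧ (g : ℤ) - 1 = g - 1) := .inr ⟨rfl, rfl⟩
    have far : (g : ℤ) - 1 ≤ |(g : ℤ) - 1 - 0| := by rw [sub_zero]; exact le_abs_self _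
    have far' : (g : ℤ) - 1 ≤ |0 - ((g : ℤ) - 1)| := by rwa [abs_sub_comm]
    fin_cases i <;> fin_cases j
    · exact h.exists_zigzag_potential hg up (.inl rfl) (.inl rfl) (.inl rfl) (.inl ⟨rfl, rfl⟩)
        (.inr rfl) (.inr rfl) (.inr rfl) (.inr rfl) far'
    · simp at hij
    · simp at hij
    · exact h.exists_zigzag_potential hg up (.inl rfl) up (.inl rfl) (.inr rfl)
        (.inl ⟨rfl, rfl⟩) (.inr rfl) (.inr rfl) (.inr rfl) far
    · exact h.exists_zigzag_potential hg (.inl rfl) up up (.inl rfl) (.inr rfl)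
        (.inr rfl) (.inl ⟨rfl, rfl⟩) (.inr rfl) (.inr rfl) far'
    · simp at hij
    · simp at hij
    · exact h.exists_zigzag_potential hg (.inl rfl) up (.inl rfl) up (.inr rfl)
        (.inr rfl) (.inr rfl) (.inl ⟨rfl, rfl⟩) (.inr rfl) far
    · exact h.exists_zigzag_potential hg (α := 0) (β := 0) (γ := 0) (.inl rfl) (.inl rfl)
        (.inl rfl) up (.inr rfl) (.inr rfl) (.inr rfl) (.inr rfl) (.inl ⟨rfl, rfl⟩) far'
  apply le_egirth_of_potential
  rintro (p | p) (q | q) hpq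
  · obtain ⟨k, κ, hl, hfar, hκ⟩ := h.exists_glued_edge_potential hg hpq
    refine ⟨Sum.elim k fun _ => κ, lipschitzOff_crossSum (fun x y hxy hne => hl x y hxy
      fun e => hne (by simpa using e)) (by simp) ?_, hfar⟩
    rintro x y ⟨i, j, -, rfl, rfl⟩ -
    exact hκ i
  · obtain ⟨i, j, hij, rfl, rfl⟩ := hpq
    exact cross i j hij
  · obtain ⟨i, j, hij, rfl, rfl⟩ := hpq
    obtain ⟨k, h1, h2⟩ := cross i j hij
    exact ⟨k, by rwa [Sym2.eq_swap], by rwa [abs_sub_comm]⟩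
  · obtain ⟨k, κ, hl, hfar, hκ⟩ := h.exists_glued_edge_potential hg hpq
    refine ⟨Sum.elim (fun _ => κ) k, lipschitzOff_crossSum (by simp) (fun x y hxy hne => hl x y hxy
      fun e => hne (by simpa using e)) ?_, hfar⟩
    rintro x y ⟨i, j, -, rfl, rfl⟩ -
    rw [abs_sub_comm]
    exact hκ j

theorem exists_gadget_of_not_scOrientable {g c : ℕ} (hg : 3 ≤ g) (hc : 4 ≤ c) {V : Type}
    [Finite V] {G : SimpleGraph V} (hG : G.HasGirthAndChromaticNumber g c)
    (hsc : ¬ G.SCOrientable) : ∃ (W : Type) (_ : Finite W) (H : SimpleGraph W),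
      H.HasGirthAndChromaticNumber g c ∧
        ∃ a₁ b₁ a₂ b₂ : W, H.IsCouplingGadget a₁ b₁ a₂ b₂ := by
  obtain ⟨R, u, v, w, hR⟩ := exists_isSeed (g := g) (c := c) (by omega) (by omega) hG.1.ge
    (chromaticNumber_le_iff_colorable.1 hG.2.le) hsc
  -- The gadget only has girth at least `g` and at most `c` colors; the disjoint summand `N` makes
  -- both values exact.
  obtain ⟨Y, _, N, ⟨hNg, hNc⟩, hNs⟩ := exists_scOrientable hg (show 3 ≤ c by omega)
  obtain ⟨k, rfl⟩ : ∃ k, c = k + 4 := ⟨c - 4, by omega⟩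
  obtain ⟨D₁, o₁, s₁, hD₁⟩ := hR.gadget_orientation
  obtain ⟨D₂, o₂, s₂⟩ := scOrientable_iff.1 hNs
  obtain ⟨C⟩ := chromaticNumber_le_iff_colorable.1 hNc.le
  have hlt : ∀ m n : ℕ, m < n → n < k + 4 → (Fin.ofNat (k + 4) m) ≠ Fin.ofNat (k + 4) n := by
    intro m n hmn hn e
    have := congrArg Fin.val e
    simp only [Fin.val_ofNat, Nat.mod_eq_of_lt hn, Nat.mod_eq_of_lt (hmn.trans hn)] at this
    omega
  have n01 := hlt 0 1 (by omega) (by omega)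
  have n02 := hlt 0 2 (by omega) (by omega)
  have n03 := hlt 0 3 (by omega) (by omega)
  have n12 := hlt 1 2 (by omega) (by omega)
  have n13 := hlt 1 3 (by omega) (by omega)
  have n23 := hlt 2 3 (by omega) (by omega)
  -- Left terminals are colored 0, 2, 0 and right ones 1, 3, 1 by `f`; `f'` uses 0, 2, 1 and 1, 3,
  -- 0, which swaps the colors on the second edge.
  obtain ⟨f, f1, f2, f3, f4⟩ := hR.gadget_coloring n02 n02.symm n13 n13.symm n01 n12.symm n23 n03 n01
  obtain ⟨f', f1', f2', f3', f4'⟩ := hR.gadget_coloring n02 n12.symm n13 n03.symm n01 n12.symm n23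
    n13 n01.symm
  have hchi : (R.gadget u v ⊕g N).chromaticNumber = (k + 4 : ℕ) :=
    chromaticNumber_eq_of_colorable hNc (colorable_sum.2 ⟨⟨f⟩, ⟨C⟩⟩) Embedding.sumInr.toHom
  obtain ⟨σ, hσ⟩ := exists_edgeOrientation (o₁.sum o₂)
  have hsum : σ.IsSC := by
    unfold EdgeOrientation.IsSC
    rw [hσ]
    exact .sum o₁ o₂ s₁ s₂
  refine ⟨_, inferInstance, R.gadget u v ⊕g N, ⟨?_, hchi⟩, .inl (.inl (terminal u v 0)),
    .inl (.inr (terminal u v 0)), .inl (.inl (terminal u v 2)), .inl (.inr (terminal u v 2)),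
    ⟨⟨σ, hsum⟩, ?_, ?_, ?_, ?_, ?_⟩⟩
  · exact egirth_eq_of_le hNg (le_egirth_sum (by omega) (hR.le_egirth_gadget (by omega)) hNg.ge)
      Embedding.sumInr.toHom Sum.inr_injective
  · exact sum_adj_inl.2 (gadget_adj_zigzag (by simp))
  · exact sum_adj_inl.2 (gadget_adj_zigzag (by simp))
  · rw [coupled_iff]
    intro D o s
    have := hR.gadget_coupled (o.pull (f := Sum.inl) fun x y hxy => sum_adj_inl.2 hxy)
      (s.of_injective Sum.inl_injective fun _ _ h => h.2)
    simpa [Digraph.pull, gadget_adj_zigzag] using this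
  · refine ⟨σ, hsum, ?_⟩
    rw [hσ]
    rintro x hx y hy ⟨p, hp⟩
    obtain ⟨x', hx', rfl⟩ : ∃ x' ∈ ({.inl (terminal u v 0), .inr (terminal u v 0)} : Set _),
        x = Sum.inl x' := by
      rcases hx with rfl | rfl
      · exact ⟨_, .inl rfl, rfl⟩
      · exact ⟨_, .inr rfl, rfl⟩
    obtain ⟨y', hy', rfl⟩ : ∃ y' ∈ ({.inl (terminal u v 2), .inr (terminal u v 2)} : Set _),
        y = Sum.inl y' := by
      rcases hy with rfl | rfl
      · exact ⟨_, .inl rfl, rfl⟩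
      · exact ⟨_, .inr rfl, rfl⟩
    rcases Digraph.reach_crossSum_inl hp.reach with ⟨t, e, ht⟩ | ⟨t, e, -⟩
    · cases e
      exact hD₁ x' hx' _ hy' ht
    · cases e
  · refine ⟨k + 4, hchi, f.sum C, f'.sum C, ⟨?_, ?_⟩, ?_, ?_⟩
    · exact f1.trans f3.symm
    · exact f2.trans f4.symm
    · exact f1'.trans f4'.symm
    · exact f2'.trans f3'.symm

end Gadget

end SimpleGraph

theorem mainTheorem8 (g c : ℕ) (hg : 3 ≤ g) (hc : 4 ≤ c) :
    (∃ (V : Type) (_ : Finite V) (G : SimpleGraph V),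
      G.HasGirthAndChromaticNumber g c ∧ ¬ G.SCOrientable) ↔
    (∃ (W : Type) (_ : Finite W) (H : SimpleGraph W),
      H.HasGirthAndChromaticNumber g c ∧
        ∃ a₁ b₁ a₂ b₂ : W, H.IsCouplingGadget a₁ b₁ a₂ b₂) := by
  constructor
  · rintro ⟨V, _, G, hG, hsc⟩
    exact SimpleGraph.exists_gadget_of_not_scOrientable hg hc hG hsc
  · rintro ⟨W, _, H, hH, a₁, b₁, a₂, b₂, h⟩
    exact SimpleGraph.exists_not_scOrientable_of_gadget hg hH h
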